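/- Let $C>0$, $G\ge 0$, $M>1$, $1<Y<2$, $b\in\mathbb R$, and let $X=(X_t)_{t\ge0}$ be a CGMY process on a probability space: a real L\'evy process (independent and stationary increments, c\`adl\`ag paths, $X_0=0$ a.s.) such that $X_1$ has L\'evy triplet $(b,0,\nu)$, i.e. $\mathbb E[e^{iuX_1}]=e^{\Psi(u)}$ for $u\in\mathbb R$, where $$\Psi(z)=izb+\int_{\mathbb R}\bigl(e^{izx}-1-izx\mathbf 1_{\{|x|\le1\}}\bigr)\,\nu(dx),\qquad \nu(dx)=\Bigl(\frac{Ce^{-G|x|}}{|x|^{1+Y}}\mathbf 1_{x<0}+\frac{Ce^{-Mx}}{x^{1+Y}}\mathbf 1_{x>0}\Bigr)dx;$$ the formula for $\Psi$ is also used for complex $z$ with $-1\le\operatorname{Im}z\le0$. Let $S_0>0$ and assume that $S_t=S_0e^{X_t}$ is a martingale with respect to its own filtration. Let $c(t,0)=\frac1{S_0}\mathbb E[(S_t-S_0)_+]$ be the normalized at-the-money call price. Put $$\theta_0(u)=C\,\Gamma(-Y)\bigl((-i)^Y+i^Y\bigr)|u|^Y,\qquad \psi_0(v)=\Psi(v-i/2)\qquad(u,v\in\mathbb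 R),$$ with principal branches of complex powers. Then: 1. $\theta_0$ is real-valued, $\theta_0(u)=-2C\,\Gamma(-Y)\,|\cos(\pi Y/2)|\,|u|^Y$, and for all $v\in\mathbb R$ $$\psi_0(v)=iv\tilde b+\kappa+C\,\Gamma(-Y)\Bigl(\bigl(M-\tfrac12-iv\bigr)^Y+\bigl(G+\tfrac12+iv\bigr)^Y\Bigr),$$ where $\tilde b=-C\,\Gamma(-Y)\bigl((M-1)^Y+(G+1)^Y-M^Y-G^Y\bigr)$ and $\kappa=\tilde b/2-C\,\Gamma(-Y)(M^Y+G^Y)$. 2. The integrals $$d_1=\frac1\pi\operatorname{Re}\int_0^\infty\frac{1-e^{\theta_0(u)}}{u^2}\,du,\qquad d_2=\frac1\pi\int_0^\infty\frac{(w^2+\frac14)\,\theta_0(w)-w^2\operatorname{Re}\psi_0(w)}{w^2(w^2+\frac14)}\,dw$$ converge absolutely, and $d_1=\frac1\pi\,\Gamma\bigl(1-\frac1Y\bigr)\bigl(2C\,\Gamma(-Y)\,|\cos(\pi Y/2)|\bigr)^{1/Y}$. 3. As $t\downarrow0$, $$c(t,0)=d_1t^{1/Y}+d_2t+o(t).$$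 -/

import Mathlib

open MeasureTheory ProbabilityTheory Filter Topology Asymptotics Set
open scoped NNReal ENNReal

noncomputable section

namespace CGMY

/-- A real-valued Lévy process indexed by `[0, ∞)`: independent and stationary increments,
càdlàg paths almost surely, and `X 0 = 0` almost surely. -/
structure IsLevyProcess {Ω : Type*} [MeasurableSpace Ω]
    (X : ℝ≥0 → Ω → ℝ) (P : Measure Ω) : Prop where
  measurable : ∀ t, Measurable (X t)
  indepIncrements : HasIndepIncrements X P
  stationaryIncrements : ∀ s t : ℝ≥0,
    IdentDistrib (fun ω => X (s + t) ω - X s ω) (fun ω => X t ω - X 0 ω) P P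
  cadlag : ∀ᵐ ω ∂P, ∀ t : ℝ≥0,
    ContinuousWithinAt (fun s => X s ω) (Ici t) t ∧
      ∃ l : ℝ, Tendsto (fun s => X s ω) (𝓝[<] t) (𝓝 l)
  zero : ∀ᵐ ω ∂P, X 0 ω = 0

/-- The Lévy–Khintchine exponent of the triplet `(b, σ, ν)`, with truncation function
`x ↦ x 1_{|x| ≤ 1}`, at a (possibly complex) argument `z`:
`i z b - σ² z² / 2 + ∫ (e^{i z x} - 1 - i z x 1_{|x| ≤ 1}) ν(dx)`. -/
def levyKhintchineExponent (b σ : ℝ) (ν : Measure ℝ) (z : ℂ) : ℂ :=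
  Complex.I * z * b - (σ : ℂ) ^ 2 * z ^ 2 / 2 +
    ∫ x : ℝ, (Complex.exp (Complex.I * z * x) - 1 -
      (if |x| ≤ 1 then Complex.I * z * x else 0)) ∂ν

/-- The random variable `ξ` has an infinitely divisible law with Lévy triplet `(b, σ, ν)`. -/
structure HasLevyTriplet {Ω : Type*} [MeasurableSpace Ω]
    (ξ : Ω → ℝ) (P : Measure Ω) (b σ : ℝ) (ν : Measure ℝ) : Prop where
  sigma_nonneg : 0 ≤ σ
  no_atom_zero : ν {0} = 0
  integrable : ∫⁻ x, ENNReal.ofReal (min 1 (x ^ 2)) ∂ν < ∞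
  charFun_eq : ∀ u : ℝ,
    charFun (P.map ξ) u = Complex.exp (levyKhintchineExponent b σ ν (u : ℂ))

/-- The density of the CGMY Lévy measure. -/
def levyDensity (C G M Y : ℝ) (x : ℝ) : ℝ :=
  if x < 0 then C * Real.exp (-G * |x|) / |x| ^ (1 + Y)
  else if 0 < x then C * Real.exp (-M * x) / x ^ (1 + Y)
  else 0

/-- The CGMY Lévy measure. -/
def levyMeasure (C G M Y : ℝ) : Measure ℝ :=
  volume.withDensity fun x => ENNReal.ofReal (levyDensity C G M Y x)

/-- `X` is a CGMY process with parameters `C > 0`, `G, M ≥ 0`, `1 < Y < 2` and drift `b`: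
a Lévy process such that `X 1` has Lévy triplet `(b, 0, ν)`. -/
structure IsCGMYProcess {Ω : Type*} [MeasurableSpace Ω]
    (X : ℝ≥0 → Ω → ℝ) (P : Measure Ω) (b C G M Y : ℝ) : Prop where
  C_pos : 0 < C
  G_nonneg : 0 ≤ G
  M_nonneg : 0 ≤ M
  one_lt_Y : 1 < Y
  Y_lt_two : Y < 2
  isLevyProcess : IsLevyProcess X P
  triplet : HasLevyTriplet (X 1) P b 0 (levyMeasure C G M Y)

/-- `S` is a martingale with respect to its own filtration. -/
def IsMartingale {Ω : Type*} [MeasurableSpace Ω]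
    (S : ℝ≥0 → Ω → ℝ) (P : Measure Ω) : Prop :=
  ∃ h : ∀ t, StronglyMeasurable (S t), Martingale S (Filtration.natural S h) P

/-- The asset price `S_t = S₀ e^{X_t}`. -/
def assetPrice {Ω : Type*} (S₀ : ℝ) (X : ℝ≥0 → Ω → ℝ) (t : ℝ≥0) (ω : Ω) : ℝ :=
  S₀ * Real.exp (X t ω)

/-- The normalized call price `c(t, k) = E[(S_t - K)₊] / S₀`, as a function of maturity `t` and
log-moneyness `k = log (S₀ / K)`, i.e. with strike `K = S₀ e^{-k}`. -/
def callPrice {Ω : Type*} [MeasurableSpace Ω]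
    (S₀ : ℝ) (X : ℝ≥0 → Ω → ℝ) (P : Measure Ω) (t : ℝ≥0) (k : ℝ) : ℝ :=
  1 / S₀ * ∫ ω, max (assetPrice S₀ X t ω - S₀ * Real.exp (-k)) 0 ∂P

/-- The characteristic exponent `Ψ` of the CGMY process, at complex arguments. -/
def charExponent (b C G M Y : ℝ) (z : ℂ) : ℂ :=
  levyKhintchineExponent b 0 (levyMeasure C G M Y) z

/-- The contour-shifted exponent `ψ₀(v) = Ψ(v - i/2)`. -/
def psi0 (b C G M Y : ℝ) (v : ℝ) : ℂ :=
  charExponent b C G M Y ((v : ℂ) - Complex.I / 2)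

/-- The exponent `θ₀(u) = C Γ(-Y) ((-i)^Y + i^Y) |u|^Y` of the limiting stable law. -/
def theta0 (C Y : ℝ) (u : ℝ) : ℂ :=
  (C : ℂ) * (Real.Gamma (-Y) : ℂ) *
    ((-Complex.I) ^ (Y : ℂ) + Complex.I ^ (Y : ℂ)) * ((|u| ^ Y : ℝ) : ℂ)

/-- The drift `b̃` in the closed form of `Ψ`, as fixed by the martingale condition. -/
def bTilde (C G M Y : ℝ) : ℝ :=
  -C * Real.Gamma (-Y) * ((M - 1) ^ Y + (G + 1) ^ Y - M ^ Y - G ^ Y)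

/-- The constant `κ = b̃ / 2 - C Γ(-Y) (M^Y + G^Y)`. -/
def kappa (C G M Y : ℝ) : ℝ :=
  bTilde C G M Y / 2 - C * Real.Gamma (-Y) * (M ^ Y + G ^ Y)

/-- The integrand in the first-order coefficient. -/
def d1Integrand (C Y : ℝ) (u : ℝ) : ℂ :=
  (1 - Complex.exp (theta0 C Y u)) / (u : ℂ) ^ 2

/-- The first-order coefficient `d₁`. -/
def d1 (C Y : ℝ) : ℝ :=
  1 / Real.pi * (∫ u in Ioi (0 : ℝ), d1Integrand C Y u).re

/-- The integrand in the second-order coefficient (`θ₀` takes real values). -/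
def d2Integrand (b C G M Y : ℝ) (w : ℝ) : ℝ :=
  ((w ^ 2 + 1 / 4) * (theta0 C Y w).re - w ^ 2 * (psi0 b C G M Y w).re) /
    (w ^ 2 * (w ^ 2 + 1 / 4))

/-- The second-order coefficient `d₂`. -/
def d2 (b C G M Y : ℝ) : ℝ :=
  1 / Real.pi * ∫ w in Ioi (0 : ℝ), d2Integrand b C G M Y w

end CGMY

end

namespace CGMY

/-! The payoff satisfies `(e^x - 1)₊ = e^x - e^{x/2} e^{-|x|/2}`, and `e^{-|x|/2}` is `1/π` times
the integral of `cos(vx)/(v² + 1/4)` over `v > 0`. Taking expectations and using `E e^{X_t} = 1`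
gives `c(t,0) = (1/π) ∫ (1 - Re e^{tψ₀(v)}) / (v² + 1/4) dv`. The stable analogue `(1/π) ∫ (1 -
e^{tθ₀(v)}) / v² dv` equals `d₁ t^{1/Y}` exactly, by scaling. The difference of the two integrands,
divided by `t`, tends pointwise to the integrand of `d₂`, so the expansion follows by dominated
convergence (`integrableOn_limit_and_tendsto`).

The domination rests on three facts about `ψ₀`: its real part is nonpositive, it differs from `θ₀`
in real part by `O((1+v)^{Y-1})`, and its imaginary part is `O(1+v)`. All but the sign come from the
closed form, which rests on `∫ (e^{-ax} - 1 + ax) x^{-1-Y} dx = Γ(-Y) a^Y` for `Re a ≥ 0`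
(`integral_expRem_mul_rpow`) and on the martingale condition `Ψ(-i) = 0`, which fixes the drift.

The law of `X_t` is tied to `Ψ` in two moves: from time `1` to time `t` through rational times and
right-continuity (`IsLevyProcess.charFun_eq`), then from the imaginary axis to the strip `0 ≤ Re z ≤
1` by the three-lines theorem (`complexMGF_eq_of_imaginary_axis`). -/

/-! ### The Gamma integral with complex rate. -/

theorem integrableOn_rpow_mul_exp_neg {s r : ℝ} (hs : 0 < s) (hr : 0 < r) :
    IntegrableOn (fun x : ℝ => x ^ (s - 1) * Real.exp (-r * x)) (Ioi 0) := by
  have := integrableOn_rpow_mul_exp_neg_mul_rpow (p := 1) (s := s - 1) (b := r)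
    (by linarith) one_pos hr
  simpa using this

/-- The power density `x ^ (s - 1)` on the positive half-line. -/
noncomputable def powerMeasure (s : ℝ) : Measure ℝ :=
  (volume.restrict (Ioi (0 : ℝ))).withDensity fun x => ENNReal.ofReal (x ^ (s - 1))

theorem integral_powerMeasure (s : ℝ) (f : ℝ → ℂ) :
    ∫ x, f x ∂powerMeasure s = ∫ x in Ioi (0 : ℝ), ((x ^ (s - 1) : ℝ) : ℂ) * f x := by
  rw [powerMeasure, integral_withDensity_eq_integral_toReal_smul (by fun_prop) (by simp)]
  refine setIntegral_congr_fun measurableSet_Ioi fun x hx => ?_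
  simp [ENNReal.toReal_ofReal (Real.rpow_nonneg (le_of_lt hx) _)]

theorem Iio_subset_integrableExpSet_powerMeasure {s : ℝ} (hs : 0 < s) :
    Iio 0 ⊆ integrableExpSet id (powerMeasure s) := by
  intro r hr
  rw [integrableExpSet, Set.mem_ofPred_eq, powerMeasure,
    integrable_withDensity_iff_integrable_smul' (by fun_prop) (by simp)]
  refine (integrableOn_rpow_mul_exp_neg hs (neg_pos.2 hr)).congr_fun (fun x hx => ?_)
    measurableSet_Ioi
  simp [ENNReal.toReal_ofReal (Real.rpow_nonneg (le_of_lt hx) _)]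

/-- The integral is the complex moment generating function of `powerMeasure s` at `-a`, analytic on
the left half-plane. It agrees with the Gamma formula on the negative reals, so the identity theorem
applies. -/
theorem integral_rpow_mul_cexp_neg {s : ℝ} (hs : 0 < s) {a : ℂ} (ha : 0 < a.re) :
    ∫ x in Ioi (0 : ℝ), ((x ^ (s - 1) : ℝ) : ℂ) * Complex.exp (-a * x) =
      (Real.Gamma s : ℂ) * a ^ (-s : ℂ) := by
  have hU : {z : ℂ | z.re < 0} ⊆ {z | z.re ∈ interior (integrableExpSet id (powerMeasure s))} :=
    fun z hz => interior_maximal (Iio_subset_integrableExpSet_powerMeasure hs) isOpen_Iio hz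
  have hopen : IsOpen {z : ℂ | z.re < 0} := isOpen_lt Complex.continuous_re continuous_const
  have h1 : AnalyticOnNhd ℂ (complexMGF id (powerMeasure s)) {z : ℂ | z.re < 0} :=
    analyticOnNhd_complexMGF.mono hU
  have h2 : AnalyticOnNhd ℂ (fun z : ℂ => (Real.Gamma s : ℂ) * (-z) ^ (-s : ℂ))
      {z : ℂ | z.re < 0} := by
    refine DifferentiableOn.analyticOnNhd (fun z hz => ?_) hopen
    have : -z ∈ Complex.slitPlane := Or.inl (by simpa using hz)
    exact ((differentiableAt_id.neg.cpow_const this).const_mul _).differentiableWithinAt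
  have hreal : ∀ r : ℝ, r < 0 → complexMGF id (powerMeasure s) (r : ℂ) =
      (Real.Gamma s : ℂ) * (-(r : ℂ)) ^ (-s : ℂ) := by
    intro r hr
    rw [complexMGF, integral_powerMeasure]
    have := Real.integral_rpow_mul_exp_neg_mul_Ioi hs (neg_pos.2 hr)
    have h3 : (-(r : ℂ)) ^ (-s : ℂ) = (((-r) ^ (-s) : ℝ) : ℂ) := by
      rw [Complex.ofReal_cpow (by linarith)]; push_cast; rfl
    rw [h3, ← Complex.ofReal_mul, Real.rpow_neg (by linarith), ← Real.inv_rpow (by linarith),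
      ← one_div, mul_comm, ← this, ← integral_complex_ofReal]
    simp
  have hE := h1.eqOn_of_preconnected_of_frequently_eq h2
    (convex_halfSpace_re_lt 0).isPreconnected (z₀ := -1) (by simp) (by
      have : ∃ᶠ x : ℝ in 𝓝[≠] (-1 : ℝ), x < 0 :=
        (eventually_nhdsWithin_of_eventually_nhds (Iio_mem_nhds (by norm_num))).frequently
      rw [frequently_iff_seq_forall] at this ⊢
      obtain ⟨xs, hx_tendsto, hx_eq⟩ := this
      refine ⟨fun n => (xs n : ℂ), ?_, fun n => hreal _ (hx_eq n)⟩
      rw [tendsto_nhdsWithin_iff] at hx_tendsto ⊢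
      refine ⟨?_, hx_tendsto.2.mono fun n hn => ?_⟩
      · have := (Complex.continuous_ofReal.tendsto (-1)).comp hx_tendsto.1
        simpa [Function.comp_def] using this
      · intro h
        apply hn
        have h' : ((xs n : ℝ) : ℂ) = ((-1 : ℝ) : ℂ) := by simpa using h
        exact_mod_cast h')
  have h4 := hE (x := -a) (by simpa using ha)
  simp only [neg_neg] at h4
  rw [← h4, complexMGF, integral_powerMeasure]
  rfl

/-! ### The compensated integral `Γ(-Y) a^Y`. -/

/-- The Taylor remainder in the Lévy–Khintchine integrand. -/
noncomputable def expRem (z : ℂ) : ℂ := Complex.exp (-z) - 1 + z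

/-- The quadratic bound serves near `x = 0`, the linear bound `norm_expRem_le` near infinity; both
use `‖e^{-z}‖ ≤ 1`. -/
theorem norm_expRem_le_sq {z : ℂ} (hz : 0 ≤ z.re) : ‖expRem z‖ ≤ 3 * ‖z‖ ^ 2 := by
  rcases le_total ‖z‖ 1 with h | h
  · have := Complex.norm_exp_sub_one_sub_id_le (x := -z) (by simpa using h)
    rw [sub_neg_eq_add, norm_neg] at this
    exact this.trans (by nlinarith [norm_nonneg z])
  · have h1 : ‖Complex.exp (-z)‖ ≤ 1 := by rw [Complex.norm_exp]; simpa using hz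
    calc ‖expRem z‖ ≤ ‖Complex.exp (-z)‖ + ‖(1 : ℂ)‖ + ‖z‖ :=
          (norm_add_le _ _).trans (by gcongr; exact norm_sub_le _ _)
      _ ≤ 3 * ‖z‖ ^ 2 := by rw [norm_one]; nlinarith

theorem norm_expRem_le {z : ℂ} (hz : 0 ≤ z.re) : ‖expRem z‖ ≤ 3 * ‖z‖ := by
  rcases le_total ‖z‖ 1 with h | h
  · exact (norm_expRem_le_sq hz).trans (by nlinarith [norm_nonneg z])
  · have h1 : ‖Complex.exp (-z)‖ ≤ 1 := by rw [Complex.norm_exp]; simpa using hz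
    calc ‖expRem z‖ ≤ ‖Complex.exp (-z)‖ + ‖(1 : ℂ)‖ + ‖z‖ :=
          (norm_add_le _ _).trans (by gcongr; exact norm_sub_le _ _)
      _ ≤ 3 * ‖z‖ := by rw [norm_one]; nlinarith

theorem norm_one_sub_exp_le {z : ℂ} (hz : 0 ≤ z.re) : ‖1 - Complex.exp (-z)‖ ≤ 4 * ‖z‖ := by
  have : 1 - Complex.exp (-z) = z - expRem z := by unfold expRem; ring
  rw [this]
  exact (norm_sub_le _ _).trans (by linarith [norm_expRem_le hz])

/-- Power functions with different exponents at `0` and `∞` are integrable. -/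
theorem integrableOn_rpow_ite {p q : ℝ} (A B : ℝ) (hp : -1 < p) (hq : q < -1) :
    IntegrableOn (fun x : ℝ => if x ≤ 1 then A * x ^ p else B * x ^ q) (Ioi 0) := by
  rw [← Ioc_union_Ioi_eq_Ioi zero_le_one]
  refine IntegrableOn.union ?_ ?_
  · have := (intervalIntegral.intervalIntegrable_rpow' (a := 0) (b := 1) hp).const_mul A
    rw [intervalIntegrable_iff_integrableOn_Ioc_of_le zero_le_one] at this
    exact this.congr_fun (fun x hx => by simp [hx.2]) measurableSet_Ioc
  · have : IntegrableOn (fun x : ℝ => B * x ^ q) (Ioi 1) :=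
      (integrableOn_Ioi_rpow_of_lt hq zero_lt_one).const_mul B
    exact this.congr_fun (fun x hx => by simp [not_le.2 (show 1 < x from hx)]) measurableSet_Ioi

/-- The exponents `1 - Y > -1` and `-Y < -1` are integrable at `0` and at infinity when `1 < Y < 2`.
The bound is uniform over `‖a‖ ≤ R`, so that it can dominate a limit in `a`. -/
theorem norm_expRem_mul_rpow_le {Y R x : ℝ} {a : ℂ} (hY : 0 < Y) (ha : 0 ≤ a.re) (hR : ‖a‖ ≤ R) (hx : 0 < x) :
    ‖expRem (a * x) * ((x ^ (-1 - Y) : ℝ) : ℂ)‖ ≤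
      if x ≤ 1 then 3 * R ^ 2 * x ^ (1 - Y) else 3 * R * x ^ (-Y) := by
  have h0 : 0 ≤ (a * x).re := by simp; positivity
  have hn : ‖a * (x : ℂ)‖ = ‖a‖ * x := by simp [abs_of_pos hx]
  have hp : ‖((x ^ (-1 - Y) : ℝ) : ℂ)‖ = x ^ (-1 - Y) := by
    rw [Complex.norm_real, Real.norm_of_nonneg (by positivity)]
  have h1 : x ^ (-Y) = x * x ^ (-1 - Y) := by
    rw [← Real.rpow_one_add' hx.le (by linarith)]; ring_nf
  have h2 : x ^ (1 - Y) = x ^ 2 * x ^ (-1 - Y) := by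
    rw [← Real.rpow_natCast, ← Real.rpow_add hx]; norm_num; ring_nf
  rw [norm_mul, hp]
  split_ifs
  · rw [h2, ← mul_assoc]
    gcongr
    refine (norm_expRem_le_sq h0).trans ?_
    rw [hn, mul_pow, ← mul_assoc]
    gcongr
  · rw [h1, ← mul_assoc]
    gcongr
    refine (norm_expRem_le h0).trans ?_
    rw [hn, ← mul_assoc]
    gcongr

theorem integrableOn_expRem_mul_rpow {Y : ℝ} (h1 : 1 < Y) (h2 : Y < 2) {a : ℂ} (ha : 0 ≤ a.re) :
    IntegrableOn (fun x : ℝ => expRem (a * x) * ((x ^ (-1 - Y) : ℝ) : ℂ)) (Ioi 0) := by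
  refine Integrable.mono' (integrableOn_rpow_ite (3 * ‖a‖ ^ 2) (3 * ‖a‖) (p := 1 - Y) (q := -Y)
    (by linarith) (by linarith)) ?_ ?_
  · unfold expRem
    exact Measurable.aestronglyMeasurable (by fun_prop)
  · exact (ae_restrict_mem measurableSet_Ioi).mono fun x hx =>
      norm_expRem_mul_rpow_le (by linarith) ha le_rfl hx

/-- Two integrations by parts, collected into one antiderivative: what is left is the Gamma
integrand with `s = 2 - Y > 0`. -/
theorem hasDerivAt_expRem_antideriv {Y : ℝ} (h1 : 1 < Y) (a : ℂ) {x : ℝ} (hx : 0 < x) :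
    HasDerivAt (fun x : ℝ => expRem (a * x) * ((-(x ^ (-Y)) / Y : ℝ) : ℂ) +
        a * (1 - Complex.exp (-(a * x))) * ((-(x ^ (1 - Y)) / (Y * (Y - 1)) : ℝ) : ℂ))
      (expRem (a * x) * ((x ^ (-1 - Y) : ℝ) : ℂ) -
        a ^ 2 / (Y * (Y - 1)) * (((x ^ (2 - Y - 1) : ℝ) : ℂ) * Complex.exp (-a * x))) x := by
  have hY : (Y : ℂ) ≠ 0 := by exact_mod_cast (by linarith : Y ≠ 0)
  have hY1 : (Y : ℂ) - 1 ≠ 0 := by exact_mod_cast (by linarith : Y - 1 ≠ 0)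
  have hl : HasDerivAt (fun x : ℝ => a * (x : ℂ)) a x := by
    simpa using (Complex.ofRealCLM.hasDerivAt (x := x)).const_mul a
  have he : HasDerivAt (fun x : ℝ => Complex.exp (-(a * (x : ℂ))))
      (Complex.exp (-(a * x)) * -a) x := hl.neg.cexp
  have hu : HasDerivAt (fun x : ℝ => expRem (a * x)) (Complex.exp (-(a * x)) * -a + a) x :=
    (he.sub_const 1).add hl
  have hp1 : HasDerivAt (fun x : ℝ => ((-(x ^ (-Y)) / Y : ℝ) : ℂ))
      ((-(-Y * x ^ (-Y - 1)) / Y : ℝ) : ℂ) x :=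
    (((Real.hasDerivAt_rpow_const (p := -Y) (Or.inl hx.ne')).neg).div_const Y).ofReal_comp
  have hp2 : HasDerivAt (fun x : ℝ => ((-(x ^ (1 - Y)) / (Y * (Y - 1)) : ℝ) : ℂ))
      ((-((1 - Y) * x ^ (1 - Y - 1)) / (Y * (Y - 1)) : ℝ) : ℂ) x :=
    (((Real.hasDerivAt_rpow_const (p := 1 - Y) (Or.inl hx.ne')).neg).div_const _).ofReal_comp
  have hF := (hu.mul hp1).add (((he.const_sub 1).const_mul a).mul hp2)
  refine hF.congr_deriv ?_
  rw [show -Y - 1 = -1 - Y by ring, show 1 - Y - 1 = -Y by ring, show 2 - Y - 1 = 1 - Y by ring,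
    neg_mul a]
  push_cast
  field_simp
  ring

theorem norm_expRem_antideriv_le {Y : ℝ} (h1 : 1 < Y) {a : ℂ} {x : ℝ} (hx : 0 < x)
    {A B : ℝ} (hA : ‖expRem (a * x)‖ ≤ A) (hB : ‖1 - Complex.exp (-(a * x))‖ ≤ B) :
    ‖expRem (a * x) * ((-(x ^ (-Y)) / Y : ℝ) : ℂ) +
        a * (1 - Complex.exp (-(a * x))) * ((-(x ^ (1 - Y)) / (Y * (Y - 1)) : ℝ) : ℂ)‖ ≤
      A * (x ^ (-Y) / Y) + ‖a‖ * B * (x ^ (1 - Y) / (Y * (Y - 1))) := by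
  have hY1 : 0 < Y - 1 := by linarith
  have hY0 : 0 < Y := by linarith
  refine (norm_add_le _ _).trans ?_
  rw [norm_mul, norm_mul, norm_mul, Complex.norm_real, Complex.norm_real, neg_div, neg_div,
    norm_neg, norm_neg, Real.norm_of_nonneg (by positivity), Real.norm_of_nonneg (by positivity)]
  gcongr

theorem integral_expRem_mul_rpow_of_re_pos {Y : ℝ} (h1 : 1 < Y) (h2 : Y < 2) {a : ℂ}
    (ha : 0 < a.re) :
    ∫ x in Ioi (0 : ℝ), expRem (a * x) * ((x ^ (-1 - Y) : ℝ) : ℂ) =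
      (Real.Gamma (-Y) : ℂ) * a ^ (Y : ℂ) := by
  have hY1 : 0 < Y - 1 := by linarith
  have hY0 : 0 < Y := by linarith
  set F : ℝ → ℂ := fun x : ℝ => expRem (a * x) * ((-(x ^ (-Y)) / Y : ℝ) : ℂ) +
        a * (1 - Complex.exp (-(a * x))) * ((-(x ^ (1 - Y)) / (Y * (Y - 1)) : ℝ) : ℂ) with hF
  have hre : ∀ x : ℝ, 0 < x → 0 ≤ (a * x).re := fun x hx => by simp; positivity
  have hn : ∀ x : ℝ, 0 < x → ‖a * (x : ℂ)‖ = ‖a‖ * x := fun x hx => by simp [abs_of_pos hx]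
  have hF0 : F 0 = 0 := by simp [hF, expRem]
  have hcont : ContinuousWithinAt F (Ici 0) 0 := by
    rw [ContinuousWithinAt, hF0]
    set K := 3 * ‖a‖ ^ 2 / Y + ‖a‖ * (4 * ‖a‖) / (Y * (Y - 1))
    have hlim : Tendsto (fun x : ℝ => K * x ^ (2 - Y)) (𝓝[≥] 0) (𝓝 0) := by
      have : ContinuousAt (fun x : ℝ => K * x ^ (2 - Y)) 0 :=
        (Real.continuousAt_rpow_const _ _ (Or.inr (by linarith))).const_mul K
      have h := this.tendsto
      rw [Real.zero_rpow (by linarith), mul_zero] at h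
      exact h.mono_left nhdsWithin_le_nhds
    refine squeeze_zero_norm' ?_ hlim
    filter_upwards [self_mem_nhdsWithin] with x hx
    rcases eq_or_lt_of_le (show (0 : ℝ) ≤ x from hx) with rfl | hx
    · rw [hF0, Real.zero_rpow (by linarith)]; simp
    · refine (norm_expRem_antideriv_le h1 hx (norm_expRem_le_sq (hre x hx))
        (norm_one_sub_exp_le (hre x hx))).trans (le_of_eq ?_)
      have e1 : x ^ (2 - Y) = x ^ 2 * x ^ (-Y) := by
        rw [← Real.rpow_natCast, ← Real.rpow_add hx]; norm_num; ring_nf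
      have e2 : x ^ (1 - Y) = x * x ^ (-Y) := by
        rw [← Real.rpow_one_add' hx.le (by linarith)]; ring_nf
      rw [hn x hx, e1, e2]
      simp only [K]
      ring
  have hlim : Tendsto F atTop (𝓝 0) := by
    set K := 3 * ‖a‖ / Y + ‖a‖ * 2 / (Y * (Y - 1))
    have hlim : Tendsto (fun x : ℝ => K * x ^ (-(Y - 1))) atTop (𝓝 0) := by
      simpa using (tendsto_rpow_neg_atTop hY1).const_mul K
    refine squeeze_zero_norm' ?_ hlim
    filter_upwards [eventually_gt_atTop 0] with x hx
    have hB : ‖1 - Complex.exp (-(a * x))‖ ≤ 2 := by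
      refine (norm_sub_le _ _).trans ?_
      have : ‖Complex.exp (-(a * x))‖ ≤ 1 := by
        rw [Complex.norm_exp]; simpa using hre x hx
      rw [norm_one]; linarith
    refine (norm_expRem_antideriv_le h1 hx (norm_expRem_le (hre x hx)) hB).trans
      (le_of_eq ?_)
    have e2 : x ^ (1 - Y) = x * x ^ (-Y) := by
      rw [← Real.rpow_one_add' hx.le (by linarith)]; ring_nf
    rw [hn x hx, show -(Y - 1) = 1 - Y by ring, e2]
    simp only [K]
    ring
  have hI1 := integrableOn_expRem_mul_rpow h1 h2 ha.le
  have hI2 : IntegrableOn (fun x : ℝ => a ^ 2 / (Y * (Y - 1)) *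
      (((x ^ (2 - Y - 1) : ℝ) : ℂ) * Complex.exp (-a * x))) (Ioi 0) := by
    refine Integrable.const_mul ?_ _
    refine (integrableOn_rpow_mul_exp_neg (s := 2 - Y) (by linarith) ha).mono' ?_ ?_
    · exact Measurable.aestronglyMeasurable (by fun_prop)
    · refine (ae_restrict_mem measurableSet_Ioi).mono fun x hx => ?_
      rw [norm_mul, Complex.norm_real, Real.norm_of_nonneg (Real.rpow_nonneg (le_of_lt hx) _),
        Complex.norm_exp]
      simp
  have hmain := integral_Ioi_of_hasDerivAt_of_tendsto hcont
    (fun x hx => hasDerivAt_expRem_antideriv h1 a hx) (hI1.sub hI2) hlim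
  rw [integral_sub hI1 hI2, integral_const_mul, hF0, sub_zero,
    integral_rpow_mul_cexp_neg (by linarith) ha, sub_eq_zero] at hmain
  rw [hmain]
  -- The functional equation, applied twice, cancels the factor `Y (Y - 1)`.
  have hG : Real.Gamma (2 - Y) = (1 - Y) * (-Y * Real.Gamma (-Y)) := by
    rw [← Real.Gamma_add_one (by linarith), show -Y + 1 = 1 - Y by ring,
      ← Real.Gamma_add_one (by linarith)]
    ring_nf
  have ha0 : a ≠ 0 := by rintro rfl; simp at ha
  have hpow : a ^ (Y : ℂ) = a ^ 2 * a ^ (-((2 - Y : ℝ) : ℂ)) := by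
    rw [← Complex.cpow_natCast, ← Complex.cpow_add _ _ ha0]; push_cast; ring_nf
  have hYc : (Y : ℂ) ≠ 0 := by exact_mod_cast (by linarith : Y ≠ 0)
  have hY1c : (Y : ℂ) - 1 ≠ 0 := by exact_mod_cast (by linarith : Y - 1 ≠ 0)
  rw [hG, hpow]
  push_cast
  field_simp
  ring

/-- The boundary `Re a = 0` is reached as the limit of `a + 1/(n+1)`. It is needed because `G = 0`
is allowed, which puts `G + ζ` on the imaginary axis for imaginary `ζ`. -/
theorem integral_expRem_mul_rpow {Y : ℝ} (h1 : 1 < Y) (h2 : Y < 2) {a : ℂ} (ha : 0 ≤ a.re) :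
    ∫ x in Ioi (0 : ℝ), expRem (a * x) * ((x ^ (-1 - Y) : ℝ) : ℂ) =
      (Real.Gamma (-Y) : ℂ) * a ^ (Y : ℂ) := by
  have hu : Tendsto (fun n : ℕ => a + ((1 / ((n : ℝ) + 1) : ℝ) : ℂ)) atTop (𝓝 a) := by
    have := (Complex.continuous_ofReal.tendsto 0).comp
      (tendsto_one_div_add_atTop_nhds_zero_nat (𝕜 := ℝ))
    simpa using this.const_add a
  have hpos : ∀ n : ℕ, 0 < (a + ((1 / ((n : ℝ) + 1) : ℝ) : ℂ)).re := fun n => by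
    rw [Complex.add_re, Complex.ofReal_re]; positivity
  have hL : Tendsto (fun n : ℕ => ∫ x in Ioi (0 : ℝ),
      expRem ((a + ((1 / ((n : ℝ) + 1) : ℝ) : ℂ)) * x) * ((x ^ (-1 - Y) : ℝ) : ℂ)) atTop
      (𝓝 (∫ x in Ioi (0 : ℝ), expRem (a * x) * ((x ^ (-1 - Y) : ℝ) : ℂ))) := by
    refine tendsto_integral_of_dominated_convergence _ (fun n => ?_)
      (integrableOn_rpow_ite (3 * (‖a‖ + 1) ^ 2) (3 * (‖a‖ + 1)) (p := 1 - Y) (q := -Y)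
        (by linarith) (by linarith)) (fun n => ?_) ?_
    · exact (integrableOn_expRem_mul_rpow h1 h2 (hpos n).le).aestronglyMeasurable
    · refine (ae_restrict_mem measurableSet_Ioi).mono fun x hx =>
        norm_expRem_mul_rpow_le (by linarith) (hpos n).le ?_ hx
      refine (norm_add_le _ _).trans ?_
      gcongr
      rw [Complex.norm_real, Real.norm_of_nonneg (by positivity)]
      exact div_le_one_of_le₀ (by linarith [n.cast_nonneg (α := ℝ)]) (by positivity)
    · refine ae_of_all _ fun x => ?_
      refine Tendsto.mul_const _ ?_
      have : Continuous fun z : ℂ => expRem (z * x) := by unfold expRem; fun_prop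
      exact (this.tendsto a).comp hu
  have hR : Tendsto (fun n : ℕ => (Real.Gamma (-Y) : ℂ) *
      (a + ((1 / ((n : ℝ) + 1) : ℝ) : ℂ)) ^ (Y : ℂ)) atTop
      (𝓝 ((Real.Gamma (-Y) : ℂ) * a ^ (Y : ℂ))) :=
    Tendsto.const_mul _ ((Complex.continuousAt_cpow_const_of_re_pos (Or.inl ha)
      (by simpa using (by linarith : 0 < Y))).tendsto.comp hu)
  refine tendsto_nhds_unique hL (hR.congr fun n => ?_)
  exact (integral_expRem_mul_rpow_of_re_pos h1 h2 (hpos n)).symm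

/-! ### Closed form of the Lévy–Khintchine exponent. -/

/-- Splitting an integral over the line into two half-line integrals. -/
theorem integrable_and_integral_eq_half_lines {h : ℝ → ℂ} {p q : ℝ → ℂ}
    (hp : IntegrableOn p (Ioi 0)) (hq : IntegrableOn q (Ioi 0))
    (hhp : ∀ x, 0 < x → h x = p x) (hhq : ∀ x, 0 < x → h (-x) = q x) :
    Integrable h ∧ ∫ x, h x = (∫ x in Ioi 0, q x) + ∫ x in Ioi 0, p x := by
  have h1 : IntegrableOn h (Ioi 0) :=
    hp.congr_fun (fun x hx => (hhp x hx).symm) measurableSet_Ioi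
  have h2 : IntegrableOn (fun x => h (-x)) (Ioi 0) :=
    hq.congr_fun (fun x hx => (hhq x hx).symm) measurableSet_Ioi
  have h3 : IntegrableOn h (Iic 0) := by
    rw [integrableOn_Iic_iff_integrableOn_Iio]
    have := h2.comp_neg
    simpa using this
  have e1 : ∫ x in Ioi 0, h x = ∫ x in Ioi 0, p x :=
    setIntegral_congr_fun measurableSet_Ioi fun x hx => hhp x hx
  have e2 : ∫ x in Iic 0, h x = ∫ x in Ioi 0, q x := by
    have := integral_comp_neg_Ioi 0 h
    rw [neg_zero] at this
    rw [← this]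
    exact setIntegral_congr_fun measurableSet_Ioi fun x hx => hhq x hx
  refine ⟨?_, ?_⟩
  · rw [← integrableOn_univ, ← Iic_union_Ioi (a := (0 : ℝ))]
    exact h3.union h1
  · rw [← setIntegral_univ, ← Iic_union_Ioi (a := (0 : ℝ)),
      setIntegral_union (Iic_disjoint_Ioi le_rfl) measurableSet_Ioi h3 h1, e1, e2]

/-- The drift correction coming from the truncation function on a half-line. -/
noncomputable def truncDrift (m Y : ℝ) : ℝ :=
  ∫ x in Ioi (0 : ℝ), (1 - if x ≤ 1 then Real.exp (-(m * x)) else 0) * x ^ (-Y)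

theorem integrableOn_truncDrift {m Y : ℝ} (hm : 0 ≤ m) (h1 : 1 < Y) (h2 : Y < 2) :
    IntegrableOn (fun x : ℝ => (1 - if x ≤ 1 then Real.exp (-(m * x)) else 0) * x ^ (-Y))
      (Ioi 0) := by
  refine (integrableOn_rpow_ite m 1 (p := 1 - Y) (q := -Y) (by linarith) (by linarith)).mono' ?_ ?_
  · refine Measurable.aestronglyMeasurable ?_
    refine Measurable.mul ?_ (by fun_prop)
    exact measurable_const.sub (Measurable.ite measurableSet_Iic (by fun_prop) measurable_const)
  · refine (ae_restrict_mem measurableSet_Ioi).mono fun x hx => ?_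
    have hx : 0 < x := hx
    have hp : 0 < x ^ (-Y) := Real.rpow_pos_of_pos hx _
    rw [norm_mul, Real.norm_of_nonneg hp.le]
    split_ifs
    · have e2 : x ^ (1 - Y) = x * x ^ (-Y) := by
        rw [← Real.rpow_one_add' hx.le (by linarith)]; ring_nf
      rw [e2, ← mul_assoc]
      gcongr
      have h3 : Real.exp (-(m * x)) ≤ 1 := Real.exp_le_one_iff.2 (by nlinarith)
      rw [Real.norm_of_nonneg (by linarith)]
      linarith [Real.add_one_le_exp (-(m * x))]
    · simp

/-- Tilting by `e^{-mx}` turns the integrand into a difference of remainders at `m + w` and `m`.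
Their linear terms leave `w x` where the truncated integrand has `w x e^{-mx}` on `x ≤ 1` only; the
mismatch is the `truncDrift` term. -/
theorem truncated_integrand {m Y : ℝ} (w : ℂ) {x : ℝ} (hx : 0 < x) :
    (Complex.exp (-(w * x)) - 1 + if x ≤ 1 then w * x else 0) *
        ((Real.exp (-(m * x)) * x ^ (-1 - Y) : ℝ) : ℂ) =
      expRem ((m + w) * x) * ((x ^ (-1 - Y) : ℝ) : ℂ) -
        expRem ((m : ℂ) * x) * ((x ^ (-1 - Y) : ℝ) : ℂ) -
        w * (((1 - if x ≤ 1 then Real.exp (-(m * x)) else 0) * x ^ (-Y) : ℝ) : ℂ) := by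
  have e : x ^ (-Y) = x * x ^ (-1 - Y) := by
    rw [show -Y = 1 + (-1 - Y) by ring, Real.rpow_add hx, Real.rpow_one]
  have e3 : Complex.exp (-((m + w) * x)) = Complex.exp (-(w * x)) * Complex.exp (-(m * x)) := by
    rw [← Complex.exp_add]; ring_nf
  rw [e, expRem, expRem, e3]
  split_ifs <;> push_cast <;> ring_nf

theorem integrableOn_truncated {m Y : ℝ} (hm : 0 ≤ m) (h1 : 1 < Y) (h2 : Y < 2) {w : ℂ}
    (hw : 0 ≤ m + w.re) :
    IntegrableOn (fun x : ℝ => (Complex.exp (-(w * x)) - 1 + if x ≤ 1 then w * x else 0) *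
        ((Real.exp (-(m * x)) * x ^ (-1 - Y) : ℝ) : ℂ)) (Ioi 0) ∧
      ∫ x in Ioi (0 : ℝ), (Complex.exp (-(w * x)) - 1 + if x ≤ 1 then w * x else 0) *
        ((Real.exp (-(m * x)) * x ^ (-1 - Y) : ℝ) : ℂ) =
      (Real.Gamma (-Y) : ℂ) * ((m + w) ^ (Y : ℂ) - (m : ℂ) ^ (Y : ℂ)) - w * truncDrift m Y := by
  have i1 := integrableOn_expRem_mul_rpow h1 h2 (a := m + w) (by simpa using hw)
  have i2 := integrableOn_expRem_mul_rpow h1 h2 (a := m) (by simpa using hm)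
  have i3 : IntegrableOn (fun x : ℝ => w * (((1 - if x ≤ 1 then Real.exp (-(m * x)) else 0) *
      x ^ (-Y) : ℝ) : ℂ)) (Ioi 0) :=
    Integrable.const_mul (Integrable.ofReal (integrableOn_truncDrift hm h1 h2)) w
  refine ⟨((i1.sub i2).sub i3).congr_fun (fun x hx => (truncated_integrand w hx).symm)
    measurableSet_Ioi, ?_⟩
  rw [setIntegral_congr_fun measurableSet_Ioi fun x hx => truncated_integrand w hx,
    integral_sub (by exact i1.sub i2) i3, integral_sub i1 i2,
    integral_expRem_mul_rpow h1 h2 (by simpa using hw),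
    integral_expRem_mul_rpow h1 h2 (by simpa using hm), integral_const_mul,
    integral_complex_ofReal, truncDrift]
  ring

/-- The Lévy–Khintchine integrand as a function of the Laplace variable. -/
noncomputable def levyIntegrand (ζ : ℂ) (x : ℝ) : ℂ :=
  Complex.exp (ζ * x) - 1 - if |x| ≤ 1 then ζ * x else 0

theorem measurable_levyDensity (C G M Y : ℝ) : Measurable (levyDensity C G M Y) := by
  unfold levyDensity
  refine Measurable.ite measurableSet_Iio (by fun_prop)
    (Measurable.ite measurableSet_Ioi (by fun_prop) measurable_const)

theorem levyDensity_nonneg {C : ℝ} (hC : 0 ≤ C) (G M Y x : ℝ) : 0 ≤ levyDensity C G M Y x := by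
  unfold levyDensity
  split_ifs <;> positivity

/-- The drift of the CGMY exponent in its closed form. -/
noncomputable def driftConst (b C G M Y : ℝ) : ℝ := b + C * (truncDrift M Y - truncDrift G Y)

/-- The closed form of the exponent, as a function of the Laplace variable. -/
noncomputable def laplaceExponent (β C G M Y : ℝ) (ζ : ℂ) : ℂ :=
  β * ζ + C * (Real.Gamma (-Y) : ℂ) *
    ((M - ζ) ^ (Y : ℂ) + (G + ζ) ^ (Y : ℂ) - (M : ℂ) ^ (Y : ℂ) - (G : ℂ) ^ (Y : ℂ))

/-- The positive half-line is the case `m = M`, `w = -ζ`; the reflected negative one is `m = G`, `w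
= ζ`. -/
theorem integrable_levyIntegrand_aux {C G M Y : ℝ} (hC : 0 ≤ C) (hG : 0 ≤ G) (hM : 0 ≤ M)
    (h1 : 1 < Y) (h2 : Y < 2) {ζ : ℂ} (hζ0 : 0 ≤ G + ζ.re) (hζ1 : ζ.re ≤ M) :
    Integrable (fun x => levyIntegrand ζ x) (levyMeasure C G M Y) ∧
      ∫ x, levyIntegrand ζ x ∂levyMeasure C G M Y =
      C * ((Real.Gamma (-Y) : ℂ) * ((G + ζ) ^ (Y : ℂ) - (G : ℂ) ^ (Y : ℂ)) - ζ * truncDrift G Y) +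
      C * ((Real.Gamma (-Y) : ℂ) * ((M + -ζ) ^ (Y : ℂ) - (M : ℂ) ^ (Y : ℂ)) -
        -ζ * truncDrift M Y) := by
  obtain ⟨p1, p2⟩ := integrableOn_truncated hM h1 h2 (w := -ζ) (by simpa using hζ1)
  obtain ⟨q1, q2⟩ := integrableOn_truncated hG h1 h2 (w := ζ) hζ0
  have hdiv : ∀ (E x : ℝ), 0 < x → C * E / x ^ (1 + Y) = C * (E * x ^ (-1 - Y)) := by
    intro E x hx
    rw [show -1 - Y = -(1 + Y) by ring, Real.rpow_neg hx.le]
    ring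
  have key := integrable_and_integral_eq_half_lines
    (h := fun x => (levyDensity C G M Y x : ℂ) * levyIntegrand ζ x)
    (p1.const_mul (C : ℂ)) (q1.const_mul (C : ℂ))
    (fun x hx => by
      simp only [levyDensity, levyIntegrand]
      rw [if_neg hx.not_gt, if_pos hx, abs_of_pos hx, hdiv _ _ hx]
      split_ifs <;> push_cast <;> ring_nf)
    (fun x hx => by
      simp only [levyDensity, levyIntegrand]
      rw [if_pos (by linarith), abs_neg, abs_of_pos hx, hdiv _ _ hx]
      split_ifs <;> push_cast <;> ring_nf)
  rw [integral_const_mul, integral_const_mul, p2, q2] at key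
  have hm : Measurable fun x => ENNReal.ofReal (levyDensity C G M Y x) :=
    (measurable_levyDensity C G M Y).ennreal_ofReal
  have hsm : ∀ x, (ENNReal.ofReal (levyDensity C G M Y x)).toReal • levyIntegrand ζ x =
      (levyDensity C G M Y x : ℂ) * levyIntegrand ζ x := fun x => by
    rw [ENNReal.toReal_ofReal (levyDensity_nonneg hC _ _ _ _), Complex.real_smul]
  rw [levyMeasure, integrable_withDensity_iff_integrable_smul' hm (by simp),
    integral_withDensity_eq_integral_toReal_smul hm (by simp)]
  simp only [hsm]
  exact key

theorem charExponent_eq_laplaceExponent {b C G M Y : ℝ} (hC : 0 ≤ C) (hG : 0 ≤ G) (hM : 0 ≤ M)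
    (h1 : 1 < Y) (h2 : Y < 2) {ζ : ℂ} (hζ0 : 0 ≤ G + ζ.re) (hζ1 : ζ.re ≤ M) {z : ℂ}
    (hz : Complex.I * z = ζ) :
    charExponent b C G M Y z = laplaceExponent (driftConst b C G M Y) C G M Y ζ := by
  have h := (integrable_levyIntegrand_aux hC hG hM h1 h2 hζ0 hζ1).2
  simp only [levyIntegrand] at h
  rw [charExponent, levyKhintchineExponent, hz, h, laplaceExponent, driftConst]
  push_cast
  ring_nf

/-- Only `Re e^{ζx} ≤ e^{x Re ζ}` is at stake, since the remaining terms have real parts depending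
on `Re ζ` alone. This bounds `e^{tL}` on the strip by its values on the segment `[0,1]`. -/
theorem re_laplaceExponent_le {b C G M Y : ℝ} (hC : 0 ≤ C) (hG : 0 ≤ G) (hM : 0 ≤ M)
    (h1 : 1 < Y) (h2 : Y < 2) {ζ : ℂ} (hζ0 : 0 ≤ G + ζ.re) (hζ1 : ζ.re ≤ M) :
    (laplaceExponent (driftConst b C G M Y) C G M Y ζ).re ≤
      (laplaceExponent (driftConst b C G M Y) C G M Y (ζ.re : ℂ)).re := by
  have e : ∀ w : ℂ, Complex.I * (-Complex.I * w) = w := fun w => by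
    rw [← mul_assoc]; simp
  rw [← charExponent_eq_laplaceExponent hC hG hM h1 h2 hζ0 hζ1 (e ζ),
    ← charExponent_eq_laplaceExponent hC hG hM h1 h2 (ζ := (ζ.re : ℂ)) (by simpa using hζ0)
      (by simpa using hζ1) (e _)]
  simp only [charExponent, levyKhintchineExponent, e]
  have i1 := (integrable_levyIntegrand_aux hC hG hM h1 h2 hζ0 hζ1).1
  have i2 := (integrable_levyIntegrand_aux hC hG hM h1 h2 (ζ := (ζ.re : ℂ)) (by simpa using hζ0)
      (by simpa using hζ1)).1
  simp only [Complex.add_re, Complex.sub_re]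
  have hle : (∫ x, levyIntegrand ζ x ∂levyMeasure C G M Y).re ≤
      (∫ x, levyIntegrand (ζ.re : ℂ) x ∂levyMeasure C G M Y).re := by
    have j1 := integral_re i1
    have j2 := integral_re i2
    simp only [RCLike.re_eq_complex_re] at j1 j2
    rw [← j1, ← j2]
    refine integral_mono i1.re i2.re fun x => ?_
    simp only [levyIntegrand, Complex.sub_re]
    have : (Complex.exp (ζ * x)).re ≤ (Complex.exp ((ζ.re : ℂ) * x)).re := by
      refine (Complex.re_le_norm _).trans (le_of_eq ?_)
      rw [Complex.norm_exp, ← Complex.ofReal_mul, ← Complex.ofReal_exp, Complex.ofReal_re]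
      simp
    split_ifs <;> simp <;> simpa using this
  simp only [levyIntegrand] at hle
  simpa using hle

/-! ### Characteristic functions of a Lévy process at all times. -/

section

variable {Ω : Type*} [MeasurableSpace Ω] {P : Measure Ω} [IsProbabilityMeasure P]

theorem IsLevyProcess.charFun_add {X : ℝ≥0 → Ω → ℝ} (hX : IsLevyProcess X P) (s t : ℝ≥0) :
    charFun (P.map (X (s + t))) = charFun (P.map (X s)) * charFun (P.map (X t)) := by
  have hi := hX.indepIncrements.indepFun_eval_sub (r := 0) (zero_le) (le_self_add : s ≤ s + t)
    hX.zero
  have h1 := hi.charFun_map_add_eq_mul (hX.measurable s).aemeasurable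
    ((hX.measurable _).sub (hX.measurable s)).aemeasurable
  rw [add_sub_cancel] at h1
  have h2 : P.map (X (s + t) - X s) = P.map (X t) := by
    have e : P.map (X (s + t) - X s) = P.map (fun ω => X t ω - X 0 ω) :=
      (hX.stationaryIncrements s t).map_eq
    rw [e]
    refine Measure.map_congr ?_
    filter_upwards [hX.zero] with ω hω
    rw [hω, sub_zero]
  rw [h1, h2]

theorem IsLevyProcess.charFun_nsmul {X : ℝ≥0 → Ω → ℝ} (hX : IsLevyProcess X P) (n : ℕ) (t : ℝ≥0) :
    charFun (P.map (X (n * t))) = charFun (P.map (X t)) ^ n := by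
  induction n with
  | zero =>
    have : P.map (X 0) = P.map (fun _ => (0 : ℝ)) := Measure.map_congr hX.zero
    ext u
    simp [this]
  | succ n ih =>
    rw [Nat.cast_succ, add_mul, one_mul, hX.charFun_add, ih, pow_succ]

/-- Continuous `n`-th roots of a non-vanishing function are determined by one value. -/
theorem eq_exp_div_of_pow_eq {n : ℕ} (hn : 0 < n) {f g : ℝ → ℂ} (hf : Continuous f)
    (hg : Continuous g) (hf0 : f 0 = 1) (hg0 : g 0 = 0) (h : ∀ u, f u ^ n = Complex.exp (g u))
    (u : ℝ) : f u = Complex.exp (g u / n) := by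
  have hn' : (n : ℂ) ≠ 0 := by exact_mod_cast hn.ne'
  set k : ℝ → ℂ := fun u => f u * Complex.exp (-(g u / n)) with hk
  have hkc : Continuous k := by fun_prop
  have hkn : range k ⊆ (Polynomial.nthRootsFinset n (1 : ℂ) : Set ℂ) := by
    rintro _ ⟨u, rfl⟩
    rw [Finset.mem_coe, Polynomial.mem_nthRootsFinset hn]
    simp only [hk]
    rw [mul_pow, h, ← Complex.exp_nat_mul, ← Complex.exp_add]
    rw [mul_neg, mul_div_cancel₀ _ hn', add_neg_cancel, Complex.exp_zero]
  have hsub := (Finset.countable_toSet _).isTotallyDisconnected _ hkn (isPreconnected_range hkc)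
  have h1 : k u = k 0 := hsub ⟨u, rfl⟩ ⟨0, rfl⟩
  simp only [hk, hf0, hg0, zero_div, neg_zero, Complex.exp_zero, mul_one] at h1
  rw [Complex.exp_neg] at h1
  exact (mul_inv_eq_one₀ (Complex.exp_ne_zero _)).1 h1

theorem IsLevyProcess.charFun_nat_div {X : ℝ≥0 → Ω → ℝ} (hX : IsLevyProcess X P) {g : ℝ → ℂ}
    (hg : Continuous g) (hg0 : g 0 = 0) (h : ∀ u, charFun (P.map (X 1)) u = Complex.exp (g u))
    (m : ℕ) {n : ℕ} (hn : 0 < n) (u : ℝ) :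
    charFun (P.map (X (m / n))) u = Complex.exp ((m / n : ℝ) * g u) := by
  have hn' : (n : ℝ≥0) ≠ 0 := by exact_mod_cast hn.ne'
  have : ∀ t, IsProbabilityMeasure (P.map (X t)) := fun t =>
    Measure.isProbabilityMeasure_map (hX.measurable t).aemeasurable
  have h1 := eq_exp_div_of_pow_eq hn (f := charFun (P.map (X (1 / n)))) continuous_charFun hg
    (by simp) hg0 (fun u => by
      rw [← h, ← Pi.pow_apply, ← hX.charFun_nsmul, mul_one_div_cancel hn']) u
  rw [div_eq_mul_one_div, hX.charFun_nsmul, Pi.pow_apply, h1, ← Complex.exp_nat_mul]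
  push_cast
  ring_nf

/-- The rationals `⌈tn⌉/n` approach `t` from the right, where the paths are continuous. -/
theorem IsLevyProcess.charFun_eq {X : ℝ≥0 → Ω → ℝ} (hX : IsLevyProcess X P) {g : ℝ → ℂ}
    (hg : Continuous g) (hg0 : g 0 = 0) (h : ∀ u, charFun (P.map (X 1)) u = Complex.exp (g u))
    (t : ℝ≥0) (u : ℝ) : charFun (P.map (X t)) u = Complex.exp ((t : ℝ) * g u) := by
  set q : ℕ → ℝ≥0 := fun n => (⌈(t : ℝ) * n⌉₊ : ℝ≥0) / (n : ℝ≥0) with hq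
  have hq' : Tendsto (fun n : ℕ => ((⌈(t : ℝ) * n⌉₊ : ℝ) / (n : ℝ))) atTop (𝓝 (t : ℝ)) :=
    (tendsto_nat_ceil_mul_div_atTop t.2).comp tendsto_natCast_atTop_atTop
  have hqt : Tendsto q atTop (𝓝[≥] t) := by
    refine tendsto_nhdsWithin_iff.2 ⟨?_, ?_⟩
    · rw [← NNReal.tendsto_coe]
      simpa [hq] using hq'
    · filter_upwards [eventually_gt_atTop 0] with n hn
      have hn' : (0 : ℝ) < n := by exact_mod_cast hn
      rw [mem_Ici, ← NNReal.coe_le_coe]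
      simp only [hq, NNReal.coe_div, NNReal.coe_natCast]
      rw [le_div_iff₀ hn']
      exact Nat.le_ceil _
  have hint : ∀ s, charFun (P.map (X s)) u = ∫ ω, Complex.exp (u * X s ω * Complex.I) ∂P :=
    fun s => by
      rw [charFun_apply_real, integral_map (hX.measurable s).aemeasurable]
      exact Measurable.aestronglyMeasurable (by fun_prop)
  have hL : Tendsto (fun n => charFun (P.map (X (q n))) u) atTop
      (𝓝 (charFun (P.map (X t)) u)) := by
    simp only [hint]
    refine tendsto_integral_of_dominated_convergence (fun _ => 1) (fun n => ?_)
      (integrable_const _) (fun n => ?_) ?_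
    · have := hX.measurable (q n)
      exact Measurable.aestronglyMeasurable (by fun_prop)
    · refine ae_of_all _ fun ω => ?_
      rw [← Complex.ofReal_mul, Complex.norm_exp_ofReal_mul_I]
    · filter_upwards [hX.cadlag] with ω hω
      have h1 := (hω t).1.tendsto.comp hqt
      have h2 : Continuous fun x : ℝ => Complex.exp (u * x * Complex.I) := by fun_prop
      exact (h2.tendsto _).comp h1
  have hR : Tendsto (fun n : ℕ => Complex.exp (((⌈(t : ℝ) * n⌉₊ / n : ℝ) : ℂ) * g u)) atTop
      (𝓝 (Complex.exp ((t : ℝ) * g u))) := by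
    have h2 : Continuous fun x : ℝ => Complex.exp (x * g u) := by fun_prop
    exact (h2.tendsto _).comp hq'
  refine tendsto_nhds_unique hL (hR.congr' ?_)
  filter_upwards [eventually_gt_atTop 0] with n hn
  exact (hX.charFun_nat_div hg hg0 h _ hn u).symm

/-! ### Exponential moments on the strip `0 ≤ Re z ≤ 1`. -/

theorem exp_mul_le_one_add_exp {σ x : ℝ} (h0 : 0 ≤ σ) (h1 : σ ≤ 1) :
    Real.exp (σ * x) ≤ 1 + Real.exp x := by
  rcases le_total 0 x with hx | hx
  · have : Real.exp (σ * x) ≤ Real.exp x := Real.exp_le_exp.2 (by nlinarith)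
    linarith
  · have : Real.exp (σ * x) ≤ 1 := Real.exp_le_one_iff.2 (by nlinarith)
    linarith [Real.exp_pos x]

theorem closure_unit_strip :
    closure (Complex.HadamardThreeLines.verticalStrip 0 1) = {z : ℂ | 0 ≤ z.re ∧ z.re ≤ 1} := by
  rw [Complex.HadamardThreeLines.verticalStrip, Complex.closure_preimage_re,
    closure_Ioo zero_ne_one]
  rfl

/-- No moment beyond `e^ξ` is assumed, so holomorphy holds only inside the strip; continuity up to
the boundary comes from domination by `1 + e^ξ`. -/
theorem diffContOnCl_complexMGF {ξ : Ω → ℝ} (hm : Measurable ξ)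
    (hint : Integrable (fun ω => Real.exp (ξ ω)) P) :
    DiffContOnCl ℂ (complexMGF ξ P) (Complex.HadamardThreeLines.verticalStrip 0 1) := by
  have hb : Integrable (fun ω => 1 + Real.exp (ξ ω)) P := (integrable_const _).add hint
  have hsub : Icc (0 : ℝ) 1 ⊆ integrableExpSet ξ P := fun σ hσ => by
    refine hb.mono' (Measurable.aestronglyMeasurable (by fun_prop)) (ae_of_all _ fun ω => ?_)
    rw [Real.norm_of_nonneg (Real.exp_pos _).le]
    exact exp_mul_le_one_add_exp hσ.1 hσ.2
  refine ⟨differentiableOn_complexMGF.mono fun z hz => ?_, ?_⟩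
  · exact interior_maximal (Ioo_subset_Icc_self.trans hsub) isOpen_Ioo hz
  · rw [closure_unit_strip]
    intro z hz
    refine continuousWithinAt_of_dominated (bound := fun ω => 1 + Real.exp (ξ ω)) ?_ ?_ hb ?_
    · exact Eventually.of_forall fun w => Measurable.aestronglyMeasurable (by fun_prop)
    · filter_upwards [self_mem_nhdsWithin] with w hw
      refine ae_of_all _ fun ω => ?_
      rw [Complex.norm_exp, Complex.re_mul_ofReal]
      exact exp_mul_le_one_add_exp hw.1 hw.2
    · exact ae_of_all _ fun ω => Continuous.continuousWithinAt (by fun_prop)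

/-- The complex moment generating function is determined on the closed strip `0 ≤ re z ≤ 1` by its
values on the imaginary axis, among bounded functions. -/
theorem complexMGF_eq_of_imaginary_axis {ξ : Ω → ℝ} (hm : Measurable ξ)
    (hint : Integrable (fun ω => Real.exp (ξ ω)) P) {h : ℂ → ℂ}
    (hd : DiffContOnCl ℂ h (Complex.HadamardThreeLines.verticalStrip 0 1)) {B : ℝ}
    (hB : ∀ z : ℂ, 0 ≤ z.re → z.re ≤ 1 → ‖h z‖ ≤ B)
    (h0 : ∀ u : ℝ, complexMGF ξ P (u * Complex.I) = h (u * Complex.I)) {z : ℂ}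
    (hz0 : 0 ≤ z.re) (hz1 : z.re ≤ 1) : complexMGF ξ P z = h z := by
  have hb : Integrable (fun ω => 1 + Real.exp (ξ ω)) P := (integrable_const _).add hint
  have hdiff := (diffContOnCl_complexMGF hm hint).sub hd
  set D := B + ∫ ω, (1 + Real.exp (ξ ω)) ∂P
  have hbound : ∀ w : ℂ, 0 ≤ w.re → w.re ≤ 1 → ‖(complexMGF ξ P - h) w‖ ≤ D := by
    intro w hw0 hw1
    rw [Pi.sub_apply]
    refine (norm_sub_le _ _).trans ?_
    rw [add_comm]
    refine add_le_add (hB w hw0 hw1) (norm_complexMGF_le_mgf.trans ?_)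
    refine integral_mono_of_nonneg (ae_of_all _ fun ω => (Real.exp_pos _).le) hb
      (ae_of_all _ fun ω => exp_mul_le_one_add_exp hw0 hw1)
  have hopen : ∀ w ∈ Complex.HadamardThreeLines.verticalStrip 0 1,
      (complexMGF ξ P - h) w = 0 := by
    intro w hw
    have hw' : 0 < w.re ∧ w.re < 1 := hw
    -- With bound `0` on `Re z = 0` and `D` on `Re z = 1`, interpolation gives `0^{1 - Re w} D^{Re
    -- w}`, which vanishes as `Re w < 1`.
    have := Complex.HadamardThreeLines.norm_le_interp_of_mem_verticalClosedStrip₀₁'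
      (complexMGF ξ P - h) (z := w) (a := 0) (b := D) ⟨hw'.1.le, hw'.2.le⟩ hdiff
      ⟨D, by rintro _ ⟨v, hv, rfl⟩; exact hbound v hv.1 hv.2⟩
      (fun v hv => by
        have hv' : v.re = 0 := hv
        have hvI : v = (v.im : ℂ) * Complex.I := by
          apply Complex.ext <;> simp [hv']
        rw [Pi.sub_apply, hvI, h0, sub_self, norm_zero])
      (fun v hv => by
        have hv' : v.re = 1 := hv
        exact hbound v (by linarith) (by linarith))
    rw [Real.zero_rpow (by linarith [hw'.2]), zero_mul] at this
    exact norm_le_zero_iff.1 this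
  have hcl : EqOn (complexMGF ξ P - h) 0 (closure (Complex.HadamardThreeLines.verticalStrip 0 1)) :=
    EqOn.of_subset_closure (s := Complex.HadamardThreeLines.verticalStrip 0 1)
      (fun w hw => hopen w hw) hdiff.2 continuousOn_const subset_closure le_rfl
  have := hcl (x := z) (by rw [closure_unit_strip]; exact ⟨hz0, hz1⟩)
  exact sub_eq_zero.1 this

theorem continuousOn_laplaceExponent {β C G M Y : ℝ} (hG : 0 ≤ G) (hM : 1 < M) (hY : 1 < Y) :
    ContinuousOn (laplaceExponent β C G M Y) {z : ℂ | 0 ≤ z.re ∧ z.re ≤ 1} := by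
  intro z hz
  have hYc : 0 < ((Y : ℝ) : ℂ).re := by simpa using (by linarith : 0 < Y)
  have c1 : ContinuousAt (fun z : ℂ => ((M : ℂ) - z) ^ (Y : ℂ)) z :=
    ContinuousAt.comp (f := fun z : ℂ => (M : ℂ) - z) (g := fun w : ℂ => w ^ (Y : ℂ))
      (Complex.continuousAt_cpow_const_of_re_pos
        (Or.inl (by rw [Complex.sub_re, Complex.ofReal_re]; linarith [hz.2])) hYc)
      (by fun_prop)
  have c2 : ContinuousAt (fun z : ℂ => ((G : ℂ) + z) ^ (Y : ℂ)) z :=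
    ContinuousAt.comp (f := fun z : ℂ => (G : ℂ) + z) (g := fun w : ℂ => w ^ (Y : ℂ))
      (Complex.continuousAt_cpow_const_of_re_pos
        (Or.inl (by rw [Complex.add_re, Complex.ofReal_re]; linarith [hz.1])) hYc)
      (by fun_prop)
  exact ContinuousAt.continuousWithinAt <| (continuousAt_id.const_mul _).add <|
    (((c1.add c2).sub_const _).sub_const _).const_mul _

theorem differentiableOn_laplaceExponent {β C G M Y : ℝ} (hG : 0 ≤ G) (hM : 1 < M) :
    DifferentiableOn ℂ (laplaceExponent β C G M Y)
      (Complex.HadamardThreeLines.verticalStrip 0 1) := by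
  intro z hz
  have hz' : 0 < z.re ∧ z.re < 1 := hz
  have c1 : DifferentiableAt ℂ (fun z : ℂ => ((M : ℂ) - z) ^ (Y : ℂ)) z :=
    DifferentiableAt.cpow_const (by fun_prop)
      (Or.inl (by rw [Complex.sub_re, Complex.ofReal_re]; linarith [hz'.2]))
  have c2 : DifferentiableAt ℂ (fun z : ℂ => ((G : ℂ) + z) ^ (Y : ℂ)) z :=
    DifferentiableAt.cpow_const (by fun_prop)
      (Or.inl (by rw [Complex.add_re, Complex.ofReal_re]; linarith [hz'.1]))
  exact DifferentiableAt.differentiableWithinAt <| (differentiableAt_id.const_mul _).add <|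
    (((c1.add c2).sub_const _).sub_const _).const_mul _

theorem laplaceExponent_zero {β C G M Y : ℝ} : laplaceExponent β C G M Y 0 = 0 := by
  simp [laplaceExponent]

/-- The exponential moments of a CGMY process in the strip of regularity. -/
theorem IsCGMYProcess.complexMGF_eq {X : ℝ≥0 → Ω → ℝ} {b C G M Y : ℝ}
    (hX : IsCGMYProcess X P b C G M Y) (hM : 1 < M)
    (hint : ∀ t, Integrable (fun ω => Real.exp (X t ω)) P) (t : ℝ≥0) {z : ℂ}
    (hz0 : 0 ≤ z.re) (hz1 : z.re ≤ 1) :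
    complexMGF (X t) P z =
      Complex.exp ((t : ℝ) * laplaceExponent (driftConst b C G M Y) C G M Y z) := by
  set L := laplaceExponent (driftConst b C G M Y) C G M Y with hL
  have hcont : ContinuousOn L {z : ℂ | 0 ≤ z.re ∧ z.re ≤ 1} :=
    continuousOn_laplaceExponent hX.G_nonneg hM hX.one_lt_Y
  have hg : Continuous fun u : ℝ => L (u * Complex.I) :=
    hcont.comp_continuous (by fun_prop) fun u => by simp
  have h1 : ∀ u, charFun (P.map (X 1)) u = Complex.exp (L (u * Complex.I)) := fun u => by
    rw [hX.triplet.charFun_eq, hL, ← charExponent_eq_laplaceExponent (b := b) hX.C_pos.le hX.G_nonneg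
      hX.M_nonneg hX.one_lt_Y hX.Y_lt_two (z := u) (by simpa using hX.G_nonneg)
      (by simpa using hX.M_nonneg) (mul_comm _ _), charExponent]
  have hchar := hX.isLevyProcess.charFun_eq hg (by simp [hL, laplaceExponent_zero]) h1 t
  have hLr : Continuous fun σ : Icc (0 : ℝ) 1 => (L ((σ : ℝ) : ℂ)).re :=
    Complex.continuous_re.comp (hcont.comp_continuous (by fun_prop)
      fun σ => ⟨by simpa using σ.2.1, by simpa using σ.2.2⟩)
  obtain ⟨B, hB⟩ := (isCompact_range hLr).bddAbove
  refine complexMGF_eq_of_imaginary_axis (hX.isLevyProcess.measurable t) (hint t)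
    (B := Real.exp (t * B)) (h := fun z => Complex.exp ((t : ℝ) * L z)) ⟨?_, ?_⟩ ?_ ?_ hz0 hz1
  · exact ((differentiableOn_laplaceExponent hX.G_nonneg hM).const_mul _).cexp
  · rw [closure_unit_strip]
    exact (hcont.const_smul ((t : ℝ) : ℂ)).cexp
  · intro w hw0 hw1
    rw [Complex.norm_exp, Complex.re_ofReal_mul]
    refine Real.exp_le_exp.2 (mul_le_mul_of_nonneg_left ?_ t.2)
    refine (re_laplaceExponent_le hX.C_pos.le hX.G_nonneg hX.M_nonneg hX.one_lt_Y hX.Y_lt_two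
      (by linarith [hX.G_nonneg]) (by linarith)).trans ?_
    exact hB ⟨⟨w.re, hw0, hw1⟩, rfl⟩
  · intro u
    rw [complexMGF_mul_I (hX.isLevyProcess.measurable t).aemeasurable, hchar]

end

/-! ### Fourier representation of the call price. -/

section

theorem integrable_one_div_sq_add_quarter :
    Integrable fun v : ℝ => 1 / (v ^ 2 + 1 / 4) := by
  refine (integrable_inv_one_add_sq.const_mul 4).mono'
    (Measurable.aestronglyMeasurable (by fun_prop)) (ae_of_all _ fun v => ?_)
  rw [Real.norm_of_nonneg (by positivity), ← div_eq_mul_inv, div_le_div_iff₀ (by positivity)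
    (by positivity)]
  nlinarith [sq_nonneg v]

-- The rate `π` is chosen so that, with kernel `e^{-2πixw}`, the transform is a multiple of `1/(w² +
-- 1/4)`.
open FourierTransform in
theorem fourier_exp_neg_pi_mul_abs (w : ℝ) :
    𝓕 (fun x : ℝ => (Real.exp (-(Real.pi * |x|)) : ℂ)) w =
      1 / (2 * Real.pi) * ((1 / (w ^ 2 + 1 / 4) : ℝ) : ℂ) ∧
    Integrable (fun x : ℝ => (Real.exp (-(Real.pi * |x|)) : ℂ)) := by
  have key : ∀ w : ℝ, Integrable (fun x : ℝ => Complex.exp ((-2 * Real.pi * x * w : ℝ) * Complex.I)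
        * (Real.exp (-(Real.pi * |x|)) : ℂ)) ∧
      ∫ x : ℝ, Complex.exp ((-2 * Real.pi * x * w : ℝ) * Complex.I) *
        (Real.exp (-(Real.pi * |x|)) : ℂ) =
      1 / (2 * Real.pi) * ((1 / (w ^ 2 + 1 / 4) : ℝ) : ℂ) := by
    intro w
    have r1 : (-(Real.pi : ℂ) - 2 * Real.pi * w * Complex.I).re < 0 := by
      simp [Real.pi_pos]
    have r2 : (-(Real.pi : ℂ) + 2 * Real.pi * w * Complex.I).re < 0 := by
      simp [Real.pi_pos]
    obtain ⟨h1, h2⟩ := integrable_and_integral_eq_half_lines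
      (h := fun x : ℝ => Complex.exp ((-2 * Real.pi * x * w : ℝ) * Complex.I) *
        (Real.exp (-(Real.pi * |x|)) : ℂ))
      (integrableOn_exp_mul_complex_Ioi r1 0) (integrableOn_exp_mul_complex_Ioi r2 0)
      (fun x hx => by
        rw [abs_of_pos hx, Complex.ofReal_exp, ← Complex.exp_add]
        push_cast; ring_nf)
      (fun x hx => by
        rw [abs_neg, abs_of_pos hx, Complex.ofReal_exp, ← Complex.exp_add]
        push_cast; ring_nf)
    refine ⟨h1, h2.trans ?_⟩
    rw [integral_exp_mul_complex_Ioi r1, integral_exp_mul_complex_Ioi r2]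
    have n1 : (-(Real.pi : ℂ) - 2 * Real.pi * w * Complex.I) ≠ 0 := fun h => by
      rw [h] at r1; simp at r1
    have n2 : (-(Real.pi : ℂ) + 2 * Real.pi * w * Complex.I) ≠ 0 := fun h => by
      rw [h] at r2; simp at r2
    have n3 : ((w : ℂ) ^ 2 + 1 / 4) ≠ 0 := by
      have h : ((w ^ 2 + 1 / 4 : ℝ) : ℂ) ≠ 0 := Complex.ofReal_ne_zero.2 (by positivity)
      push_cast at h
      exact h
    have n4 : (Real.pi : ℂ) ≠ 0 := by exact_mod_cast Real.pi_ne_zero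
    have e : (-(Real.pi : ℂ) + 2 * Real.pi * w * Complex.I) *
        (-(Real.pi : ℂ) - 2 * Real.pi * w * Complex.I) =
        4 * Real.pi ^ 2 * ((w : ℂ) ^ 2 + 1 / 4) := by
      linear_combination (-4 * (Real.pi : ℂ) ^ 2 * w ^ 2) * Complex.I_sq
    push_cast
    rw [mul_zero, mul_zero, Complex.exp_zero, div_add_div _ _ n2 n1, e]
    field_simp
    ring
  refine ⟨?_, by simpa using (key 0).1⟩
  rw [Real.fourier_real_eq_integral_exp_smul]
  simpa only [smul_eq_mul] using (key w).2

-- Fourier inversion of the preceding transform at the point `x/(2π)`; evenness in `v` folds the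
-- line onto the half-line.
open FourierTransform in
theorem integral_cos_div_sq_add_quarter (x : ℝ) :
    ∫ v in Ioi (0 : ℝ), Real.cos (v * x) / (v ^ 2 + 1 / 4) =
      Real.pi * Real.exp (-(|x| / 2)) := by
  have hpi := Real.pi_pos
  have hpi' : (Real.pi : ℂ) ≠ 0 := by exact_mod_cast Real.pi_ne_zero
  set f : ℝ → ℂ := fun x : ℝ => (Real.exp (-(Real.pi * |x|)) : ℂ) with hf
  have hF : 𝓕 f = fun w => 1 / (2 * Real.pi) * ((1 / (w ^ 2 + 1 / 4) : ℝ) : ℂ) :=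
    funext fun w => (fourier_exp_neg_pi_mul_abs w).1
  have hFi : Integrable (𝓕 f) := by
    rw [hF]
    exact (integrable_one_div_sq_add_quarter.ofReal).const_mul _
  have hinv := (fourier_exp_neg_pi_mul_abs 0).2.fourierInv_fourier_eq hFi (v := x / (2 * Real.pi))
    (Continuous.continuousAt (by fun_prop))
  rw [Real.fourierInv_eq', hF] at hinv
  have hre := congrArg Complex.re hinv
  have hint : Integrable fun v : ℝ => Complex.exp ((2 * Real.pi * inner ℝ v (x / (2 * Real.pi)) : ℝ)
      * Complex.I) • (1 / (2 * Real.pi) * ((1 / (v ^ 2 + 1 / 4) : ℝ) : ℂ)) := by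
    rw [hF] at hFi
    refine hFi.mono (Measurable.aestronglyMeasurable (by fun_prop)) (ae_of_all _ fun v => ?_)
    rw [norm_smul, Complex.norm_exp_ofReal_mul_I, one_mul]
  have hre2 := integral_re hint
  simp only [RCLike.re_eq_complex_re] at hre2
  rw [← hre2, Complex.ofReal_re] at hre
  have hcongr : ∀ v : ℝ, (Complex.exp ((2 * Real.pi * inner ℝ v (x / (2 * Real.pi)) : ℝ)
      * Complex.I) • (1 / (2 * Real.pi) * ((1 / (v ^ 2 + 1 / 4) : ℝ) : ℂ))).re =
      1 / (2 * Real.pi) * (Real.cos (|v| * x) / (|v| ^ 2 + 1 / 4)) := by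
    intro v
    have e1 : 2 * Real.pi * inner ℝ v (x / (2 * Real.pi)) = v * x := by
      simp only [RCLike.inner_apply, conj_trivial]
      field_simp
    have e2 : (1 / (2 * (Real.pi : ℂ)) * ((1 / (v ^ 2 + 1 / 4) : ℝ) : ℂ)) =
      ((1 / (2 * Real.pi) * (1 / (v ^ 2 + 1 / 4)) : ℝ) : ℂ) := by push_cast; rfl
    have e3 : Real.cos (|v| * x) = Real.cos (v * x) := by
      rcases abs_choice v with h | h <;> rw [h]
      rw [neg_mul, Real.cos_neg]
    rw [e1, e2, smul_eq_mul, Complex.re_mul_ofReal, Complex.exp_ofReal_mul_I_re, e3, sq_abs]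
    ring
  simp only [hcongr] at hre
  rw [integral_const_mul,
    integral_comp_abs (f := fun v => Real.cos (v * x) / (v ^ 2 + 1 / 4))] at hre
  have e4 : Real.pi * |x / (2 * Real.pi)| = |x| / 2 := by
    rw [abs_div, abs_of_pos (by positivity : 0 < 2 * Real.pi)]
    field_simp
  rw [e4] at hre
  rw [← hre, ← mul_assoc, ← mul_assoc]
  rw [show Real.pi * (1 / (2 * Real.pi)) * 2 = 1 by field_simp, one_mul]

/-- Both sides are `min(e^x, 1)`. -/
theorem exp_half_mul_exp_neg_abs_half (x : ℝ) :
    Real.exp (x / 2) * Real.exp (-(|x| / 2)) = Real.exp x - max (Real.exp x - 1) 0 := by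
  rw [← Real.exp_add]
  rcases le_total 0 x with h | h
  · rw [abs_of_nonneg h, max_eq_left (by linarith [Real.one_le_exp h])]
    ring_nf
    exact Real.exp_zero
  · rw [abs_of_nonpos h, max_eq_right (by linarith [Real.exp_le_one_iff.2 h])]
    ring_nf

variable {Ω : Type*} [MeasurableSpace Ω] {P : Measure Ω} [IsProbabilityMeasure P]

/-- Fourier representation of the at-the-money call payoff. -/
theorem integral_max_exp_sub_one {ξ : Ω → ℝ} (hm : Measurable ξ)
    (hint : Integrable (fun ω => Real.exp (ξ ω)) P) (h1 : ∫ ω, Real.exp (ξ ω) ∂P = 1) :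
    ∫ ω, max (Real.exp (ξ ω) - 1) 0 ∂P = 1 / Real.pi * ∫ v in Ioi (0 : ℝ),
      (1 - (complexMGF ξ P (1 / 2 + v * Complex.I)).re) / (v ^ 2 + 1 / 4) := by
  have hhalf : Integrable (fun ω => Real.exp (ξ ω / 2)) P := by
    refine ((integrable_const (1 : ℝ)).add hint).mono' (Measurable.aestronglyMeasurable
      (by fun_prop)) (ae_of_all _ fun ω => ?_)
    rw [Real.norm_of_nonneg (Real.exp_pos _).le]
    have := exp_mul_le_one_add_exp (σ := 1 / 2) (x := ξ ω) (by norm_num) (by norm_num)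
    rw [one_div_mul_eq_div] at this
    exact this
  have hK := integrable_one_div_sq_add_quarter.integrableOn (s := Ioi 0)
  -- Fubini is justified by the product bound `e^{ξ/2} / (v² + 1/4)`.
  have hprod : Integrable (Function.uncurry fun (v : ℝ) (ω : Ω) =>
      Real.exp (ξ ω / 2) * (Real.cos (v * ξ ω) / (v ^ 2 + 1 / 4)))
      ((volume.restrict (Ioi 0)).prod P) := by
    refine (Integrable.mul_prod hK hhalf).mono' (Measurable.aestronglyMeasurable
      (by unfold Function.uncurry; fun_prop)) (ae_of_all _ fun p => ?_)
    simp only [Function.uncurry]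
    rw [norm_mul, norm_div, Real.norm_of_nonneg (Real.exp_pos _).le, mul_comm]
    gcongr
    · exact Real.abs_cos_le_one _
    · exact le_abs_self _
  have hre : ∀ v : ℝ, (complexMGF ξ P (1 / 2 + v * Complex.I)).re =
      ∫ ω, Real.exp (ξ ω / 2) * Real.cos (v * ξ ω) ∂P := by
    intro v
    have e : ∀ ω, Complex.exp ((1 / 2 + v * Complex.I) * ξ ω) =
        (Real.exp (ξ ω / 2) : ℂ) * Complex.exp ((v * ξ ω : ℝ) * Complex.I) := fun ω => by
      rw [Complex.ofReal_exp, ← Complex.exp_add]; push_cast; ring_nf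
    have hi : Integrable (fun ω => (Real.exp (ξ ω / 2) : ℂ) *
        Complex.exp ((v * ξ ω : ℝ) * Complex.I)) P := by
      refine hhalf.mono' (Measurable.aestronglyMeasurable (by fun_prop)) (ae_of_all _ fun ω => ?_)
      rw [norm_mul, Complex.norm_exp_ofReal_mul_I, Complex.norm_real,
        Real.norm_of_nonneg (Real.exp_pos _).le, mul_one]
    have h := integral_re hi
    simp only [RCLike.re_eq_complex_re, Complex.re_ofReal_mul, Complex.exp_ofReal_mul_I_re] at h
    rw [complexMGF, h]
    simp only [e]
  have hswap := integral_integral_swap hprod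
  have hl : ∀ v : ℝ, ∫ ω, Real.exp (ξ ω / 2) * (Real.cos (v * ξ ω) / (v ^ 2 + 1 / 4)) ∂P =
      (complexMGF ξ P (1 / 2 + v * Complex.I)).re / (v ^ 2 + 1 / 4) := by
    intro v
    rw [hre, ← integral_div]
    simp only [mul_div_assoc]
  have hmaxi : Integrable (fun ω => max (Real.exp (ξ ω) - 1) 0) P :=
    (hint.sub (integrable_const _)).pos_part
  have hr : ∀ ω, ∫ v in Ioi (0 : ℝ), Real.exp (ξ ω / 2) *
      (Real.cos (v * ξ ω) / (v ^ 2 + 1 / 4)) =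
      Real.pi * (Real.exp (ξ ω) - max (Real.exp (ξ ω) - 1) 0) := by
    intro ω
    rw [integral_const_mul, integral_cos_div_sq_add_quarter, ← exp_half_mul_exp_neg_abs_half]
    ring
  simp only [hl, hr] at hswap
  rw [integral_const_mul, integral_sub hint hmaxi, h1] at hswap
  have hli : IntegrableOn (fun v : ℝ =>
      (complexMGF ξ P (1 / 2 + v * Complex.I)).re / (v ^ 2 + 1 / 4)) (Ioi 0) := by
    have := hprod.integral_prod_left
    simp only [Function.uncurry, hl] at this
    exact this
  -- At `x = 0` the total mass of the kernel is `π`, which turns the constant `1 = E e^ξ` into an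
  -- integral.
  have h0 := integral_cos_div_sq_add_quarter 0
  simp only [mul_zero, Real.cos_zero, abs_zero, zero_div, neg_zero, Real.exp_zero, mul_one] at h0
  simp only [sub_div]
  rw [integral_sub hK hli, h0, hswap]
  field_simp
  ring

end

/-! ### The stable integral giving the first-order coefficient. -/

theorem integrableOn_one_sub_exp_div_sq {Y c : ℝ} (h1 : 1 < Y) (hc : 0 < c) :
    IntegrableOn (fun v : ℝ => (1 - Real.exp (-c * v ^ Y)) / v ^ 2) (Ioi 0) := by
  refine (integrableOn_rpow_ite c 1 (p := Y - 2) (q := -2) (by linarith) (by norm_num)).mono'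
    (Measurable.aestronglyMeasurable (by fun_prop)) ?_
  refine (ae_restrict_mem measurableSet_Ioi).mono fun v hv => ?_
  have hv : 0 < v := hv
  have hp : 0 < v ^ Y := Real.rpow_pos_of_pos hv _
  have h2 : Real.exp (-c * v ^ Y) ≤ 1 := Real.exp_le_one_iff.2 (by nlinarith)
  rw [Real.norm_of_nonneg (div_nonneg (by linarith) (by positivity))]
  split_ifs
  · rw [Real.rpow_sub hv, Real.rpow_two, ← mul_div_assoc]
    gcongr
    linarith [Real.add_one_le_exp (-c * v ^ Y)]
  · rw [Real.rpow_neg hv.le, Real.rpow_two, one_mul, ← one_div]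
    gcongr
    linarith [Real.exp_pos (-c * v ^ Y)]

/-- Integration by parts against `-1/v` reduces this to a Gamma integral. Taking `c = tk` later
produces the exact factor `t^{1/Y}`. -/
theorem integral_one_sub_exp_div_sq {Y c : ℝ} (h1 : 1 < Y) (hc : 0 < c) :
    ∫ v in Ioi (0 : ℝ), (1 - Real.exp (-c * v ^ Y)) / v ^ 2 =
      c ^ (1 / Y) * Real.Gamma (1 - 1 / Y) := by
  have hY : 0 < Y := by linarith
  set F : ℝ → ℝ := fun v => -((1 - Real.exp (-c * v ^ Y)) / v) with hF
  have hle : ∀ v : ℝ, 0 < v → Real.exp (-c * v ^ Y) ≤ 1 := fun v hv =>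
    Real.exp_le_one_iff.2 (by nlinarith [Real.rpow_pos_of_pos hv Y])
  have hF0 : F 0 = 0 := by simp [hF]
  have hnorm : ∀ v : ℝ, 0 < v → ‖F v‖ = (1 - Real.exp (-c * v ^ Y)) / v := fun v hv => by
    rw [norm_neg, Real.norm_of_nonneg (div_nonneg (by linarith [hle v hv]) hv.le)]
  have hcont : ContinuousWithinAt F (Ici 0) 0 := by
    rw [ContinuousWithinAt, hF0]
    have hlim : Tendsto (fun x : ℝ => c * x ^ (Y - 1)) (𝓝[≥] 0) (𝓝 0) := by
      have : ContinuousAt (fun x : ℝ => c * x ^ (Y - 1)) 0 :=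
        (Real.continuousAt_rpow_const _ _ (Or.inr (by linarith))).const_mul c
      have h := this.tendsto
      rw [Real.zero_rpow (by linarith), mul_zero] at h
      exact h.mono_left nhdsWithin_le_nhds
    refine squeeze_zero_norm' ?_ hlim
    filter_upwards [self_mem_nhdsWithin] with v hv
    rcases eq_or_lt_of_le (show (0 : ℝ) ≤ v from hv) with rfl | hv
    · rw [hF0, Real.zero_rpow (by linarith)]; simp
    · rw [hnorm v hv, Real.rpow_sub hv, Real.rpow_one, ← mul_div_assoc]
      gcongr
      linarith [Real.add_one_le_exp (-c * v ^ Y)]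
  have hlim : Tendsto F atTop (𝓝 0) := by
    refine squeeze_zero_norm' ?_ tendsto_inv_atTop_zero
    filter_upwards [eventually_gt_atTop 0] with v hv
    rw [hnorm v hv, ← one_div]
    gcongr
    linarith [Real.exp_pos (-c * v ^ Y)]
  have hderiv : ∀ v ∈ Ioi (0 : ℝ), HasDerivAt F ((1 - Real.exp (-c * v ^ Y)) / v ^ 2 -
      c * Y * (v ^ (Y - 2) * Real.exp (-c * v ^ Y))) v := by
    intro v hv
    have hv : 0 < v := hv
    have hd := ((((Real.hasDerivAt_rpow_const (p := Y) (Or.inl hv.ne')).const_mul (-c)).exp.const_sub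
      1).div (hasDerivAt_id v) hv.ne').neg
    refine hd.congr_deriv ?_
    have e : v ^ (Y - 1) = v * v ^ (Y - 2) := by
      rw [show Y - 1 = 1 + (Y - 2) by ring, Real.rpow_add hv, Real.rpow_one]
    rw [e]
    simp only [id]
    field_simp
    ring
  have hI := integrableOn_one_sub_exp_div_sq h1 hc
  have hJ : IntegrableOn (fun v : ℝ => c * Y * (v ^ (Y - 2) * Real.exp (-c * v ^ Y))) (Ioi 0) :=
    Integrable.const_mul (integrableOn_rpow_mul_exp_neg_mul_rpow (by linarith) hY hc) _
  have hmain := integral_Ioi_of_hasDerivAt_of_tendsto hcont hderiv (hI.sub hJ) hlim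
  rw [integral_sub hI hJ, integral_const_mul,
    integral_rpow_mul_exp_neg_mul_rpow hY (by linarith) hc, hF0, sub_zero, sub_eq_zero] at hmain
  rw [hmain, show (Y - 2 + 1) / Y = 1 - 1 / Y by field_simp; ring,
    show -(Y - 2 + 1) / Y = 1 / Y - 1 by field_simp; ring, Real.rpow_sub hc, Real.rpow_one]
  field_simp

/-! ### Dominated convergence for the second-order term. -/

/-- The bound that dominates the difference quotients of the option price integrand. -/
noncomputable def priceBound (k K A Y v : ℝ) : ℝ :=
  k * (v ^ Y / (4 * v ^ 2 * (v ^ 2 + 1 / 4))) +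
    (K * (1 + v) ^ (Y - 1) / (v ^ 2 + 1 / 4) + A * (1 + v) ^ (2 - Y) / (v ^ 2 + 1 / 4))

theorem integrableOn_one_add_rpow_div {q : ℝ} (hq : q < 1) (A : ℝ) :
    IntegrableOn (fun v : ℝ => A * (1 + v) ^ q / (v ^ 2 + 1 / 4)) (Ioi 0) := by
  have hb : IntegrableOn (fun v : ℝ => 8 * |A| * (v + 1) ^ (q - 2)) (Ioi 0) :=
    (integrableOn_add_rpow_Ioi_of_lt (by linarith) (by norm_num)).const_mul _
  refine hb.mono' (Measurable.aestronglyMeasurable (by fun_prop)) ?_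
  refine (ae_restrict_mem measurableSet_Ioi).mono fun v hv => ?_
  have hv : 0 < v := hv
  have hp : 0 < (1 + v) ^ q := Real.rpow_pos_of_pos (by linarith) _
  rw [norm_div, norm_mul, Real.norm_of_nonneg hp.le,
    Real.norm_of_nonneg (by positivity : 0 ≤ v ^ 2 + 1 / 4), add_comm v 1,
    Real.rpow_sub (by linarith), Real.rpow_two, Real.norm_eq_abs, ← mul_div_assoc,
    div_le_div_iff₀ (by positivity) (by positivity)]
  have : (1 + v) ^ 2 ≤ 8 * (v ^ 2 + 1 / 4) := by nlinarith [sq_nonneg (v - 1)]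
  calc |A| * (1 + v) ^ q * (1 + v) ^ 2 ≤ |A| * (1 + v) ^ q * (8 * (v ^ 2 + 1 / 4)) := by gcongr
    _ = _ := by ring

theorem integrableOn_priceBound (k K A : ℝ) {Y : ℝ} (h1 : 1 < Y) (h2 : Y < 2) :
    IntegrableOn (priceBound k K A Y) (Ioi 0) := by
  refine Integrable.add (Integrable.const_mul ?_ _) (Integrable.add
    (integrableOn_one_add_rpow_div (by linarith) K) (integrableOn_one_add_rpow_div (by linarith) A))
  refine (integrableOn_rpow_ite 1 1 (p := Y - 2) (q := Y - 4) (by linarith) (by linarith)).mono'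
    (Measurable.aestronglyMeasurable (by fun_prop)) ?_
  refine (ae_restrict_mem measurableSet_Ioi).mono fun v hv => ?_
  have hv : 0 < v := hv
  have hp : 0 < v ^ Y := Real.rpow_pos_of_pos hv _
  rw [Real.norm_of_nonneg (by positivity), one_mul, one_mul]
  split_ifs
  · rw [Real.rpow_sub hv, Real.rpow_two]
    gcongr
    nlinarith [sq_nonneg v, pow_pos hv 2]
  · rw [Real.rpow_sub hv, show v ^ (4 : ℝ) = v ^ 4 by exact_mod_cast Real.rpow_natCast v 4]
    gcongr
    nlinarith [pow_pos hv 2, pow_pos hv 4]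

theorem abs_exp_sub_exp_le {x y : ℝ} (hx : x ≤ 0) (hy : y ≤ 0) :
    |Real.exp x - Real.exp y| ≤ |x - y| := by
  wlog h : y ≤ x generalizing x y
  · rw [abs_sub_comm, abs_sub_comm x]
    exact this hy hx (le_of_not_ge h)
  rw [abs_of_nonneg (sub_nonneg.2 (Real.exp_le_exp.2 h)), abs_of_nonneg (by linarith)]
  have h1 : Real.exp x ≤ 1 := Real.exp_le_one_iff.2 hx
  have h2 : Real.exp y = Real.exp x * Real.exp (y - x) := by rw [← Real.exp_add]; ring_nf
  have h3 := Real.add_one_le_exp (y - x)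
  nlinarith [Real.exp_pos x]

/-- The error from the oscillating factor, controlled by the decay of the stable part. -/
theorem oscillation_bound {Y k K : ℝ} (h1 : 1 < Y) (h2 : Y < 2) (hk : 0 < k) (hK : 0 ≤ K) :
    ∃ A : ℝ, ∀ v r s t : ℝ, 0 < v → r ≤ 0 → |r + k * v ^ Y| ≤ K * (1 + v) ^ (Y - 1) →
      |s| ≤ K * (1 + v) → 0 < t → t ≤ 1 →
      t * s ^ 2 * Real.exp (t * r) ≤ A * (1 + v) ^ (2 - Y) := by
  -- Beyond `V` one has `1 + v ≤ 2v` and `4K ≤ kv`, so the error `K (1+v)^{Y-1}` is at most half of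
  -- `k v^Y` and hence `r ≤ -k v^Y / 2`.
  set V := max 1 (4 * K / k) with hV
  have hV1 : 1 ≤ V := le_max_left _ _
  refine ⟨K ^ 2 * (1 + V) ^ 2 + 8 * K ^ 2 / k, ?_⟩
  intro v r s t hv hr hb hs ht ht1
  have hv1 : 0 < 1 + v := by linarith
  have hs2 : s ^ 2 ≤ K ^ 2 * (1 + v) ^ 2 := by
    rw [← sq_abs, ← mul_pow]; gcongr
  have hp0 : 1 ≤ (1 + v) ^ (2 - Y) := Real.one_le_rpow (by linarith) (by linarith)
  have he : Real.exp (t * r) ≤ 1 := Real.exp_le_one_iff.2 (by nlinarith)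
  rcases lt_or_ge v V with h | h
  · calc t * s ^ 2 * Real.exp (t * r) ≤ 1 * (K ^ 2 * (1 + V) ^ 2) * 1 := by
          gcongr
          exact hs2.trans (by gcongr)
      _ ≤ (K ^ 2 * (1 + V) ^ 2 + 8 * K ^ 2 / k) * 1 := by
          have : 0 ≤ 8 * K ^ 2 / k := by positivity
          linarith
      _ ≤ _ := by gcongr
  · have hv1' : 1 ≤ v := hV1.trans h
    have hpY1 : 0 < v ^ (Y - 1) := Real.rpow_pos_of_pos hv _
    have hvY : v ^ Y = v * v ^ (Y - 1) := by
      rw [show Y = 1 + (Y - 1) by ring, Real.rpow_add hv, Real.rpow_one]; ring_nf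
    have hpY : 0 < v ^ Y := Real.rpow_pos_of_pos hv _
    have e1 : (1 + v) ^ (Y - 1) ≤ 2 * v ^ (Y - 1) := by
      calc (1 + v) ^ (Y - 1) ≤ (2 * v) ^ (Y - 1) :=
            Real.rpow_le_rpow (by linarith) (by linarith) (by linarith)
        _ = 2 ^ (Y - 1) * v ^ (Y - 1) := Real.mul_rpow (by norm_num) hv.le
        _ ≤ 2 ^ (1 : ℝ) * v ^ (Y - 1) := by
            gcongr
            · norm_num
            · linarith
        _ = _ := by rw [Real.rpow_one]
    have hKv : 4 * K ≤ k * v := by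
      have := (le_max_right 1 (4 * K / k)).trans h
      rw [div_le_iff₀ hk] at this
      linarith
    have hr2 : k * v ^ Y / 2 ≤ -r := by
      have h3 := (abs_le.1 hb).2
      have h4 : K * (1 + v) ^ (Y - 1) ≤ K * (2 * v ^ (Y - 1)) := by gcongr
      have h5 : 4 * K * v ^ (Y - 1) ≤ k * v * v ^ (Y - 1) := by gcongr
      rw [hvY] at h3 ⊢
      nlinarith
    -- The inequality `x e^{-x} ≤ 1` trades the factor `t` for decay `v^{-Y}`. Without it `s²/(v² +
    -- 1/4)` would only be bounded, not integrable.
    have hte : t * (-r) * Real.exp (t * r) ≤ 1 := by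
      have h3 := Real.add_one_le_exp (-(t * r))
      have h4 : Real.exp (-(t * r)) * Real.exp (t * r) = 1 := by
        rw [← Real.exp_add, neg_add_cancel, Real.exp_zero]
      nlinarith [Real.exp_pos (t * r)]
    have hte2 : t * Real.exp (t * r) ≤ 2 / (k * v ^ Y) := by
      rw [le_div_iff₀ (by positivity)]
      have : t * Real.exp (t * r) * (k * v ^ Y / 2) ≤ t * Real.exp (t * r) * (-r) := by gcongr
      nlinarith
    have e2 : (1 + v) ^ Y ≤ 4 * v ^ Y := by
      calc (1 + v) ^ Y ≤ (2 * v) ^ Y :=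
            Real.rpow_le_rpow (by linarith) (by linarith) (by linarith)
        _ = 2 ^ Y * v ^ Y := Real.mul_rpow (by norm_num) hv.le
        _ ≤ 2 ^ (2 : ℝ) * v ^ Y := by
            gcongr
            norm_num
        _ = _ := by norm_num
    have e3 : (1 + v) ^ 2 = (1 + v) ^ Y * (1 + v) ^ (2 - Y) := by
      rw [← Real.rpow_add hv1, ← Real.rpow_two]; ring_nf
    calc t * s ^ 2 * Real.exp (t * r) = s ^ 2 * (t * Real.exp (t * r)) := by ring
      _ ≤ K ^ 2 * (1 + v) ^ 2 * (2 / (k * v ^ Y)) := by gcongr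
      _ ≤ K ^ 2 * (4 * v ^ Y * (1 + v) ^ (2 - Y)) * (2 / (k * v ^ Y)) := by
          rw [e3]; gcongr
      _ = 8 * K ^ 2 / k * (1 + v) ^ (2 - Y) := by field_simp; ring
      _ ≤ _ := by
          gcongr
          have : 0 ≤ K ^ 2 * (1 + V) ^ 2 := by positivity
          linarith

/-- The integrand of the difference between the price and its leading term. -/
noncomputable def priceDiff (k Y r s v t : ℝ) : ℝ :=
  (1 - Real.exp (t * r) * Real.cos (t * s)) / (v ^ 2 + 1 / 4) -
    (1 - Real.exp (-(t * k) * v ^ Y)) / v ^ 2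

/-- Three errors, one for each term of `priceBound`: replacing `r` by the stable exponent, the
oscillating cosine, and the change of kernel `1/v² - 1/(v² + 1/4) = 1/(4v²(v² + 1/4))`. -/
theorem abs_priceDiff_le {Y k K A v r s t : ℝ} (hk : 0 < k) (hv : 0 < v)
    (hr : r ≤ 0) (hb : |r + k * v ^ Y| ≤ K * (1 + v) ^ (Y - 1)) (ht : 0 < t)
    (hA : t * s ^ 2 * Real.exp (t * r) ≤ A * (1 + v) ^ (2 - Y)) :
    |priceDiff k Y r s v t| ≤ t * priceBound k K A Y v := by
  have hpY : 0 < v ^ Y := Real.rpow_pos_of_pos hv _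
  have hD : 0 < v ^ 2 + 1 / 4 := by positivity
  set θ := -(t * k) * v ^ Y with hθ
  have hθ0 : θ ≤ 0 := by
    have : 0 < t * k * v ^ Y := by positivity
    linarith [neg_mul (t * k) (v ^ Y)]
  have hsplit : priceDiff k Y r s v t = (Real.exp θ - Real.exp (t * r)) / (v ^ 2 + 1 / 4) +
      Real.exp (t * r) * (1 - Real.cos (t * s)) / (v ^ 2 + 1 / 4) -
      (1 - Real.exp θ) / (4 * v ^ 2 * (v ^ 2 + 1 / 4)) := by
    rw [priceDiff, ← hθ]
    field_simp
    ring
  have b1 : |(Real.exp θ - Real.exp (t * r)) / (v ^ 2 + 1 / 4)| ≤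
      t * (K * (1 + v) ^ (Y - 1)) / (v ^ 2 + 1 / 4) := by
    rw [abs_div, abs_of_pos hD]
    gcongr
    refine (abs_exp_sub_exp_le hθ0 (by nlinarith)).trans ?_
    have : θ - t * r = -(t * (r + k * v ^ Y)) := by rw [hθ]; ring
    rw [this, abs_neg, abs_mul, abs_of_pos ht]
    gcongr
  have b2 : |Real.exp (t * r) * (1 - Real.cos (t * s)) / (v ^ 2 + 1 / 4)| ≤
      t * (A * (1 + v) ^ (2 - Y)) / (v ^ 2 + 1 / 4) := by
    have hc := Real.one_sub_sq_div_two_le_cos (x := t * s)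
    rw [abs_div, abs_of_pos hD, abs_of_nonneg (mul_nonneg (Real.exp_pos _).le
      (by linarith [Real.cos_le_one (t * s)]))]
    refine div_le_div_of_nonneg_right ?_ hD.le
    have h3 : Real.exp (t * r) * (1 - Real.cos (t * s)) ≤ Real.exp (t * r) * ((t * s) ^ 2 / 2) := by
      gcongr; linarith
    have h4 : t * (t * s ^ 2 * Real.exp (t * r)) ≤ t * (A * (1 + v) ^ (2 - Y)) := by gcongr
    have h5 : 0 ≤ t * (t * s ^ 2 * Real.exp (t * r)) := by positivity
    calc _ ≤ _ := h3
      _ = t * (t * s ^ 2 * Real.exp (t * r)) / 2 := by ring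
      _ ≤ _ := by linarith
  have b3 : |(1 - Real.exp θ) / (4 * v ^ 2 * (v ^ 2 + 1 / 4))| ≤
      t * k * v ^ Y / (4 * v ^ 2 * (v ^ 2 + 1 / 4)) := by
    rw [abs_div, abs_of_pos (by positivity : 0 < 4 * v ^ 2 * (v ^ 2 + 1 / 4)),
      abs_of_nonneg (by linarith [Real.exp_le_one_iff.2 hθ0])]
    gcongr
    have := Real.add_one_le_exp θ
    rw [hθ] at this ⊢
    linarith
  rw [hsplit]
  rw [← Real.norm_eq_abs] at b1 b2 b3 ⊢
  refine (norm_sub_le _ _).trans ((add_le_add ((norm_add_le _ _).trans (add_le_add b1 b2))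
    b3).trans (le_of_eq ?_))
  rw [priceBound]
  ring

/-- The limit is the derivative at `t = 0`; `s` drops out because the cosine is stationary there. -/
theorem tendsto_priceDiff_div (k Y r s v : ℝ) (hv : 0 < v) :
    Tendsto (fun t => priceDiff k Y r s v t / t) (𝓝[>] 0)
      (𝓝 (((v ^ 2 + 1 / 4) * (-k * v ^ Y) - v ^ 2 * r) / (v ^ 2 * (v ^ 2 + 1 / 4)))) := by
  have hlin : ∀ c : ℝ, HasDerivAt (fun t : ℝ => t * c) c 0 := fun c => by
    simpa using (hasDerivAt_id (0 : ℝ)).mul_const c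
  have h1 : HasDerivAt (fun t : ℝ => Real.exp (t * r) * Real.cos (t * s)) r 0 := by
    simpa using (hlin r).exp.fun_mul (hlin s).cos
  have h2 : HasDerivAt (fun t : ℝ => Real.exp (-(t * k) * v ^ Y)) (-k * v ^ Y) 0 := by
    simpa using ((hlin k).neg.mul_const (v ^ Y)).exp
  have h3 : HasDerivAt (priceDiff k Y r s v) ((-r) / (v ^ 2 + 1 / 4) - (-(-k * v ^ Y)) / v ^ 2) 0 :=
    ((h1.const_sub 1).div_const _).sub ((h2.const_sub 1).div_const _)
  have h4 := h3.tendsto_slope_zero_right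
  have h0 : priceDiff k Y r s v 0 = 0 := by simp [priceDiff]
  simp only [zero_add, h0, sub_zero, smul_eq_mul] at h4
  have hD : v ^ 2 + 1 / 4 ≠ 0 := by positivity
  have e : (-r) / (v ^ 2 + 1 / 4) - (-(-k * v ^ Y)) / v ^ 2 =
      ((v ^ 2 + 1 / 4) * (-k * v ^ Y) - v ^ 2 * r) / (v ^ 2 * (v ^ 2 + 1 / 4)) := by
    field_simp
    ring
  rw [e] at h4
  exact h4.congr fun t => by rw [div_eq_inv_mul]

/-- The analytic core, stated for any `r` and `s` with the required growth. The limit integrand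
inherits the dominating bound, so absolute convergence of `d₂` comes at no extra cost. -/
theorem integrableOn_limit_and_tendsto {Y k K : ℝ} (h1 : 1 < Y) (h2 : Y < 2) (hk : 0 < k)
    (hK : 0 ≤ K) {r s : ℝ → ℝ} (hrm : Measurable r) (hsm : Measurable s)
    (hr : ∀ v, 0 < v → r v ≤ 0)
    (hb : ∀ v, 0 < v → |r v + k * v ^ Y| ≤ K * (1 + v) ^ (Y - 1))
    (hs : ∀ v, 0 < v → |s v| ≤ K * (1 + v)) :
    IntegrableOn (fun v : ℝ => ((v ^ 2 + 1 / 4) * (-k * v ^ Y) - v ^ 2 * r v) /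
      (v ^ 2 * (v ^ 2 + 1 / 4))) (Ioi 0) ∧
    Tendsto (fun t => ((∫ v in Ioi (0 : ℝ),
        (1 - Real.exp (t * r v) * Real.cos (t * s v)) / (v ^ 2 + 1 / 4)) -
        t ^ (1 / Y) * (k ^ (1 / Y) * Real.Gamma (1 - 1 / Y))) / t) (𝓝[>] 0)
      (𝓝 (∫ v in Ioi (0 : ℝ), ((v ^ 2 + 1 / 4) * (-k * v ^ Y) - v ^ 2 * r v) /
        (v ^ 2 * (v ^ 2 + 1 / 4)))) := by
  obtain ⟨A, hA⟩ := oscillation_bound h1 h2 hk hK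
  have hB := integrableOn_priceBound k K A h1 h2
  have hle : ∀ v t : ℝ, 0 < v → 0 < t → t ≤ 1 →
      ‖priceDiff k Y (r v) (s v) v t / t‖ ≤ priceBound k K A Y v := fun v t hv ht ht1 => by
    rw [norm_div, Real.norm_of_nonneg ht.le, div_le_iff₀ ht, mul_comm, Real.norm_eq_abs]
    exact abs_priceDiff_le hk hv (hr v hv) (hb v hv) ht
      (hA v (r v) (s v) t hv (hr v hv) (hb v hv) (hs v hv) ht ht1)
  have hev : ∀ᶠ t : ℝ in 𝓝[>] 0, 0 < t ∧ t ≤ 1 :=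
    (eventually_mem_nhdsWithin.and (eventually_nhdsWithin_of_eventually_nhds
      (Iic_mem_nhds one_pos)))
  have hmeas : ∀ t, Measurable fun v => priceDiff k Y (r v) (s v) v t := fun t => by
    unfold priceDiff; fun_prop
  refine ⟨?_, ?_⟩
  · refine hB.mono' (Measurable.aestronglyMeasurable (by fun_prop)) ?_
    refine (ae_restrict_mem measurableSet_Ioi).mono fun v hv => ?_
    exact le_of_tendsto (tendsto_priceDiff_div k Y (r v) (s v) v hv).norm
      (hev.mono fun t ht => hle v t hv ht.1 ht.2)
  · have hdom : Tendsto (fun t => ∫ v in Ioi (0 : ℝ), priceDiff k Y (r v) (s v) v t / t) (𝓝[>] 0)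
        (𝓝 (∫ v in Ioi (0 : ℝ), ((v ^ 2 + 1 / 4) * (-k * v ^ Y) - v ^ 2 * r v) /
          (v ^ 2 * (v ^ 2 + 1 / 4)))) := by
      refine tendsto_integral_filter_of_dominated_convergence _ (Eventually.of_forall fun t =>
        ((hmeas t).div_const t).aestronglyMeasurable) ?_ hB ?_
      · exact hev.mono fun t ht => (ae_restrict_mem measurableSet_Ioi).mono fun v hv =>
          hle v t hv ht.1 ht.2
      · exact (ae_restrict_mem measurableSet_Ioi).mono fun v hv =>
          tendsto_priceDiff_div k Y (r v) (s v) v hv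
    refine hdom.congr' (hev.mono fun t ht => ?_)
    have htk : 0 < t * k := mul_pos ht.1 hk
    have i1 : IntegrableOn (fun v : ℝ =>
        (1 - Real.exp (t * r v) * Real.cos (t * s v)) / (v ^ 2 + 1 / 4)) (Ioi 0) := by
      refine ((integrable_one_div_sq_add_quarter.const_mul 2).integrableOn).mono'
        (Measurable.aestronglyMeasurable (by fun_prop)) ?_
      refine (ae_restrict_mem measurableSet_Ioi).mono fun v hv => ?_
      rw [norm_div, Real.norm_of_nonneg (by positivity : 0 ≤ v ^ 2 + 1 / 4), ← mul_div_assoc,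
        mul_one]
      gcongr
      refine (norm_sub_le _ _).trans ?_
      rw [norm_mul, norm_one, Real.norm_of_nonneg (Real.exp_pos _).le, Real.norm_eq_abs]
      have h3 : Real.exp (t * r v) ≤ 1 :=
        Real.exp_le_one_iff.2 (mul_nonpos_of_nonneg_of_nonpos ht.1.le (hr v hv))
      nlinarith [Real.abs_cos_le_one (t * s v), Real.exp_pos (t * r v), abs_nonneg
        (Real.cos (t * s v))]
    have i2 := integrableOn_one_sub_exp_div_sq h1 htk
    simp only [priceDiff]
    rw [integral_div, integral_sub i1 i2, integral_one_sub_exp_div_sq h1 htk,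
      Real.mul_rpow ht.1.le hk.le, mul_assoc]

/-! ### The stable exponent and its distance to the shifted exponent. -/

theorem Gamma_neg_pos {Y : ℝ} (h1 : 1 < Y) (h2 : Y < 2) : 0 < Real.Gamma (-Y) := by
  have hG : Real.Gamma (2 - Y) = (1 - Y) * (-Y * Real.Gamma (-Y)) := by
    rw [← Real.Gamma_add_one (by linarith), show -Y + 1 = 1 - Y by ring,
      ← Real.Gamma_add_one (by linarith)]
    ring_nf
  have hpos : 0 < Real.Gamma (2 - Y) := Real.Gamma_pos_of_pos (by linarith)
  rw [hG, show (1 - Y) * (-Y * Real.Gamma (-Y)) = ((Y - 1) * Y) * Real.Gamma (-Y) by ring] at hpos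
  exact (pos_iff_pos_of_mul_pos hpos).1 (by nlinarith)

theorem cos_pi_mul_half_neg {Y : ℝ} (h1 : 1 < Y) (h2 : Y < 2) : Real.cos (Real.pi * Y / 2) < 0 :=
  Real.cos_neg_of_pi_div_two_lt_of_lt (by nlinarith [Real.pi_pos]) (by nlinarith [Real.pi_pos])

theorem I_cpow_ofReal (Y : ℝ) :
    Complex.I ^ (Y : ℂ) = Complex.exp ((Real.pi * Y / 2 : ℝ) * Complex.I) := by
  rw [Complex.cpow_def_of_ne_zero Complex.I_ne_zero, Complex.log_I]
  push_cast
  ring_nf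

theorem neg_I_cpow_ofReal (Y : ℝ) :
    (-Complex.I) ^ (Y : ℂ) = Complex.exp (-((Real.pi * Y / 2 : ℝ) * Complex.I)) := by
  rw [Complex.cpow_def_of_ne_zero (neg_ne_zero.2 Complex.I_ne_zero), Complex.log_neg_I]
  push_cast
  ring_nf

theorem neg_I_cpow_add_I_cpow (Y : ℝ) : (-Complex.I) ^ (Y : ℂ) + Complex.I ^ (Y : ℂ) =
    ((2 * Real.cos (Real.pi * Y / 2) : ℝ) : ℂ) := by
  rw [I_cpow_ofReal, neg_I_cpow_ofReal]
  push_cast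
  rw [Complex.two_cos, neg_mul, add_comm]

theorem ofReal_mul_cpow {v : ℝ} (hv : 0 < v) {w : ℂ} (hw : w ≠ 0) (Y : ℝ) :
    (v * w : ℂ) ^ (Y : ℂ) = ((v ^ Y : ℝ) : ℂ) * w ^ (Y : ℂ) := by
  have hv' : (v : ℂ) ≠ 0 := Complex.ofReal_ne_zero.2 hv.ne'
  rw [Complex.cpow_def_of_ne_zero (mul_ne_zero hv' hw), Complex.log_ofReal_mul hv hw, add_mul,
    Complex.exp_add, Complex.cpow_def_of_ne_zero hw, Real.rpow_def_of_pos hv]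
  push_cast
  rfl

theorem theta0_eq {C Y : ℝ} (h1 : 1 < Y) (h2 : Y < 2) (u : ℝ) : theta0 C Y u =
    ((-(2 * C * Real.Gamma (-Y) * |Real.cos (Real.pi * Y / 2)|) * |u| ^ Y : ℝ) : ℂ) := by
  rw [theta0, neg_I_cpow_add_I_cpow, abs_of_neg (cos_pi_mul_half_neg h1 h2)]
  push_cast
  ring

/-- Mean value inequality along `x + w`, `0 ≤ x ≤ a`. Since `w` is not real, the segment avoids the
branch cut, and `‖x + w‖ ≤ (a + 1)(1 + v)`. -/
theorem norm_add_cpow_sub_cpow_le {Y a v : ℝ} (h1 : 1 < Y) (ha : 0 ≤ a) (hv : 0 < v) {w : ℂ}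
    (him : w.im ≠ 0) (hn : ‖w‖ = v) :
    ‖(a + w) ^ (Y : ℂ) - w ^ (Y : ℂ)‖ ≤ Y * a * (a + 1) ^ (Y - 1) * (1 + v) ^ (Y - 1) := by
  have hder : ∀ x ∈ Icc (0 : ℝ) a, HasDerivWithinAt (fun x : ℝ => ((x : ℂ) + w) ^ (Y : ℂ))
      (Y * ((x : ℂ) + w) ^ ((Y : ℂ) - 1)) (Icc 0 a) x := by
    intro x _
    have h3 : HasDerivAt (fun z : ℂ => (z + w) ^ (Y : ℂ))
        (Y * ((x : ℂ) + w) ^ ((Y : ℂ) - 1) * 1) x :=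
      ((hasDerivAt_id (x : ℂ)).add_const w).cpow_const (Or.inr (by simpa using him))
    rw [mul_one] at h3
    exact h3.comp_ofReal.hasDerivWithinAt
  have hbound : ∀ x ∈ Ico (0 : ℝ) a, ‖Y * ((x : ℂ) + w) ^ ((Y : ℂ) - 1)‖ ≤
      Y * ((a + 1) ^ (Y - 1) * (1 + v) ^ (Y - 1)) := by
    intro x hx
    have e : ((Y : ℂ) - 1) = ((Y - 1 : ℝ) : ℂ) := by push_cast; rfl
    rw [e, norm_mul, Complex.norm_cpow_real, Complex.norm_real, Real.norm_of_nonneg (by linarith),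
      ← Real.mul_rpow (by linarith) (by linarith)]
    refine mul_le_mul_of_nonneg_left (Real.rpow_le_rpow (norm_nonneg _) ?_ (by linarith))
      (by linarith)
    · refine (norm_add_le _ _).trans ?_
      rw [hn, Complex.norm_real, Real.norm_of_nonneg hx.1]
      nlinarith [hx.2]
  have := norm_image_sub_le_of_norm_deriv_le_segment' hder hbound a ⟨ha, le_rfl⟩
  simp only [Complex.ofReal_zero, zero_add, sub_zero] at this
  exact this.trans (le_of_eq (by ring))

/-- The closed form of the contour-shifted exponent. -/
noncomputable def shiftedExponent (C G M Y : ℝ) (v : ℝ) : ℂ :=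
  Complex.I * v * (bTilde C G M Y : ℂ) + (kappa C G M Y : ℂ) +
    (C : ℂ) * (Real.Gamma (-Y) : ℂ) *
      (((M - 1 / 2 : ℝ) - Complex.I * v) ^ (Y : ℂ) + ((G + 1 / 2 : ℝ) + Complex.I * v) ^ (Y : ℂ))

theorem measurable_shiftedExponent (C G M Y : ℝ) : Measurable (shiftedExponent C G M Y) := by
  unfold shiftedExponent
  fun_prop

/-- The shifted exponent is the stable exponent plus a linear drift and a lower-order error. -/
theorem exists_shiftedExponent_bound {C G M Y : ℝ} (hC : 0 < C) (hG : 0 ≤ G) (hM : 1 < M)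
    (h1 : 1 < Y) (h2 : Y < 2) : ∃ K : ℝ, 0 ≤ K ∧ ∀ v : ℝ, 0 < v →
      |(shiftedExponent C G M Y v).re +
        2 * C * Real.Gamma (-Y) * |Real.cos (Real.pi * Y / 2)| * v ^ Y| ≤ K * (1 + v) ^ (Y - 1) ∧
      |(shiftedExponent C G M Y v).im| ≤ K * (1 + v) := by
  have hΓ := Gamma_neg_pos h1 h2
  set m := M - 1 / 2
  set g := G + 1 / 2
  have hm : 0 < m := by simp only [m]; linarith
  have hg : 0 < g := by simp only [g]; linarith
  set K₁ := C * Real.Gamma (-Y) * (Y * m * (m + 1) ^ (Y - 1) + Y * g * (g + 1) ^ (Y - 1))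
  have hK₁ : 0 ≤ K₁ := by positivity
  refine ⟨|kappa C G M Y| + |bTilde C G M Y| + K₁, by positivity, fun v hv => ?_⟩
  have hpow : 1 ≤ (1 + v) ^ (Y - 1) := Real.one_le_rpow (by linarith) (by linarith)
  have hpow2 : (1 + v) ^ (Y - 1) ≤ 1 + v := by
    calc (1 + v) ^ (Y - 1) ≤ (1 + v) ^ (1 : ℝ) :=
          Real.rpow_le_rpow_of_exponent_le (by linarith) (by linarith)
      _ = 1 + v := Real.rpow_one _
  set w := Complex.I * (v : ℂ) with hw
  have hwn : ‖w‖ = v := by simp [hw, abs_of_pos hv]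
  have hwre : w.re = 0 := by simp [hw]
  have hwim : w.im = v := by simp [hw]
  -- `E` collects the effect of the shifts `m` and `g`; without them, the two powers at `∓iv` add up
  -- to the stable exponent.
  set E := (C : ℂ) * (Real.Gamma (-Y) : ℂ) *
    (((m + -w) ^ (Y : ℂ) - (-w) ^ (Y : ℂ)) + ((g + w) ^ (Y : ℂ) - w ^ (Y : ℂ))) with hE
  have hEn : ‖E‖ ≤ K₁ * (1 + v) ^ (Y - 1) := by
    have b1 := norm_add_cpow_sub_cpow_le h1 hm.le hv (w := -w)
      (by simp [hwim, hv.ne']) (by rw [norm_neg, hwn])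
    have b2 := norm_add_cpow_sub_cpow_le h1 hg.le hv (w := w) (by simp [hwim, hv.ne']) hwn
    rw [hE, norm_mul, norm_mul, Complex.norm_real, Complex.norm_real, Real.norm_of_nonneg hC.le,
      Real.norm_of_nonneg hΓ.le]
    calc _ ≤ C * Real.Gamma (-Y) * (Y * m * (m + 1) ^ (Y - 1) * (1 + v) ^ (Y - 1) +
          Y * g * (g + 1) ^ (Y - 1) * (1 + v) ^ (Y - 1)) := by
          gcongr
          exact (norm_add_le _ _).trans (add_le_add b1 b2)
      _ = _ := by simp only [K₁]; ring
  have hst : (-w) ^ (Y : ℂ) + w ^ (Y : ℂ) =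
      ((2 * Real.cos (Real.pi * Y / 2) * v ^ Y : ℝ) : ℂ) := by
    have e1 : w ^ (Y : ℂ) = ((v ^ Y : ℝ) : ℂ) * Complex.I ^ (Y : ℂ) := by
      rw [← ofReal_mul_cpow hv Complex.I_ne_zero, hw, mul_comm]
    have e2 : (-w) ^ (Y : ℂ) = ((v ^ Y : ℝ) : ℂ) * (-Complex.I) ^ (Y : ℂ) := by
      rw [← ofReal_mul_cpow hv (neg_ne_zero.2 Complex.I_ne_zero), hw, mul_neg, mul_comm]
    rw [e1, e2, ← mul_add, neg_I_cpow_add_I_cpow, ← Complex.ofReal_mul]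
    ring_nf
  have hdec : shiftedExponent C G M Y v = w * (bTilde C G M Y : ℂ) +
      ((kappa C G M Y - 2 * C * Real.Gamma (-Y) * |Real.cos (Real.pi * Y / 2)| * v ^ Y : ℝ) : ℂ)
      + E := by
    have : ((2 * C * Real.Gamma (-Y) * Real.cos (Real.pi * Y / 2) * v ^ Y : ℝ) : ℂ) =
        (C : ℂ) * (Real.Gamma (-Y) : ℂ) * ((-w) ^ (Y : ℂ) + w ^ (Y : ℂ)) := by
      rw [hst]; push_cast; ring
    rw [abs_of_neg (cos_pi_mul_half_neg h1 h2), mul_neg, neg_mul, sub_neg_eq_add,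
      Complex.ofReal_add, this, hE, shiftedExponent, ← hw, sub_eq_add_neg]
    ring
  have hre : (shiftedExponent C G M Y v).re + 2 * C * Real.Gamma (-Y) *
      |Real.cos (Real.pi * Y / 2)| * v ^ Y = kappa C G M Y + E.re := by
    rw [hdec, Complex.add_re, Complex.add_re, Complex.re_mul_ofReal, hwre, Complex.ofReal_re]
    ring
  have him : (shiftedExponent C G M Y v).im = v * bTilde C G M Y + E.im := by
    rw [hdec, Complex.add_im, Complex.add_im, Complex.im_mul_ofReal, hwim, Complex.ofReal_im]
    ring
  have hk := abs_nonneg (kappa C G M Y)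
  have hb := abs_nonneg (bTilde C G M Y)
  refine ⟨?_, ?_⟩
  · rw [hre]
    refine (abs_add_le _ _).trans ?_
    have := (Complex.abs_re_le_norm E).trans hEn
    nlinarith
  · rw [him]
    refine (abs_add_le _ _).trans ?_
    have := (Complex.abs_im_le_norm E).trans hEn
    rw [abs_mul, abs_of_pos hv]
    nlinarith

/-! ### Consequences of the martingale property and the price formula. -/

theorem IsMartingale.integrable_exp {Ω : Type*} [MeasurableSpace Ω] {P : Measure Ω}
    {X : ℝ≥0 → Ω → ℝ} {S₀ : ℝ} (hS₀ : 0 < S₀)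
    (hS : IsMartingale (assetPrice S₀ X) P) (t : ℝ≥0) :
    Integrable (fun ω => Real.exp (X t ω)) P := by
  obtain ⟨h, hm⟩ := hS
  have := (hm.integrable t).const_mul S₀⁻¹
  refine this.congr (ae_of_all _ fun ω => ?_)
  simp only [assetPrice]
  rw [inv_mul_cancel_left₀ hS₀.ne']

variable {Ω : Type*} [MeasurableSpace Ω] {P : Measure Ω} [IsProbabilityMeasure P]

theorem IsMartingale.integral_exp {X : ℝ≥0 → Ω → ℝ} {S₀ : ℝ} (hS₀ : 0 < S₀)
    (hX : IsLevyProcess X P) (hS : IsMartingale (assetPrice S₀ X) P) (t : ℝ≥0) :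
    ∫ ω, Real.exp (X t ω) ∂P = 1 := by
  obtain ⟨h, hm⟩ := hS
  have h1 := hm.setIntegral_eq (zero_le (a := t)) MeasurableSet.univ
  rw [setIntegral_univ, setIntegral_univ] at h1
  have h0 : ∫ ω, assetPrice S₀ X 0 ω ∂P = S₀ := by
    have : (fun ω => assetPrice S₀ X 0 ω) =ᵐ[P] fun _ => S₀ := by
      filter_upwards [hX.zero] with ω hω
      simp [assetPrice, hω]
    rw [integral_congr_ae this]
    simp
  simp only [assetPrice] at h1 h0
  rw [h0, integral_const_mul] at h1
  exact (mul_eq_left₀ hS₀.ne').1 h1.symm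

/-- The martingale condition determines the drift. -/
theorem IsCGMYProcess.driftConst_eq {X : ℝ≥0 → Ω → ℝ} {b C G M Y S₀ : ℝ}
    (hX : IsCGMYProcess X P b C G M Y) (hM : 1 < M) (hS₀ : 0 < S₀)
    (hS : IsMartingale (assetPrice S₀ X) P) : driftConst b C G M Y = bTilde C G M Y := by
  have h := hX.complexMGF_eq hM (hS.integrable_exp hS₀) 1 (z := ((1 : ℝ) : ℂ)) (by simp) (by simp)
  rw [complexMGF_ofReal, mgf] at h
  simp only [one_mul] at h
  rw [hS.integral_exp hS₀ hX.isLevyProcess] at h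
  have hG := hX.G_nonneg
  have e : laplaceExponent (driftConst b C G M Y) C G M Y ((1 : ℝ) : ℂ) =
      ((driftConst b C G M Y + C * Real.Gamma (-Y) *
        ((M - 1) ^ Y + (G + 1) ^ Y - M ^ Y - G ^ Y) : ℝ) : ℂ) := by
    rw [laplaceExponent, ← Complex.ofReal_sub, ← Complex.ofReal_add,
      ← Complex.ofReal_cpow (by linarith), ← Complex.ofReal_cpow (by linarith),
      ← Complex.ofReal_cpow (by linarith), ← Complex.ofReal_cpow (by linarith)]
    push_cast
    ring
  -- The exponent at `1` is real, so `e^L = 1` forces `L = 0` with no `2πi` ambiguity.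
  rw [e, NNReal.coe_one, Complex.ofReal_one, one_mul, ← Complex.ofReal_exp,
    ← Complex.ofReal_one, Complex.ofReal_inj, eq_comm, Real.exp_eq_one_iff] at h
  rw [bTilde]
  linarith

theorem laplaceExponent_half_add (C G M Y : ℝ) (hG : 0 ≤ G) (hM : 0 ≤ M) (v : ℝ) :
    laplaceExponent (bTilde C G M Y) C G M Y (1 / 2 + v * Complex.I) =
      shiftedExponent C G M Y v := by
  have e1 : (M : ℂ) - (1 / 2 + v * Complex.I) = (M - 1 / 2 : ℝ) - Complex.I * v := by
    push_cast; ring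
  have e2 : (G : ℂ) + (1 / 2 + v * Complex.I) = (G + 1 / 2 : ℝ) + Complex.I * v := by
    push_cast; ring
  rw [laplaceExponent, e1, e2, shiftedExponent, kappa, ← Complex.ofReal_cpow hM,
    ← Complex.ofReal_cpow hG]
  push_cast
  ring

theorem IsCGMYProcess.psi0_eq {X : ℝ≥0 → Ω → ℝ} {b C G M Y S₀ : ℝ}
    (hX : IsCGMYProcess X P b C G M Y) (hM : 1 < M) (hS₀ : 0 < S₀)
    (hS : IsMartingale (assetPrice S₀ X) P) (v : ℝ) :
    psi0 b C G M Y v = shiftedExponent C G M Y v := by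
  have hG := hX.G_nonneg
  rw [psi0, charExponent_eq_laplaceExponent (ζ := 1 / 2 + v * Complex.I) hX.C_pos.le hG
    hX.M_nonneg hX.one_lt_Y hX.Y_lt_two (by simp; linarith) (by simp; linarith)
    (by linear_combination (-1 / 2 : ℂ) * Complex.I_sq), hX.driftConst_eq hM hS₀ hS,
    laplaceExponent_half_add C G M Y hG hX.M_nonneg]

theorem IsCGMYProcess.complexMGF_half {X : ℝ≥0 → Ω → ℝ} {b C G M Y S₀ : ℝ}
    (hX : IsCGMYProcess X P b C G M Y) (hM : 1 < M) (hS₀ : 0 < S₀)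
    (hS : IsMartingale (assetPrice S₀ X) P) (t : ℝ≥0) (v : ℝ) :
    complexMGF (X t) P (1 / 2 + v * Complex.I) =
      Complex.exp ((t : ℝ) * shiftedExponent C G M Y v) := by
  rw [hX.complexMGF_eq hM (hS.integrable_exp hS₀) t (by simp) (by simp; norm_num),
    hX.driftConst_eq hM hS₀ hS, laplaceExponent_half_add C G M Y hX.G_nonneg hX.M_nonneg]

/-- On the line `Re z = 1/2`, `|E e^{zX₁}| ≤ E e^{X₁/2} ≤ (1 + E e^{X₁})/2 = 1`. -/
theorem IsCGMYProcess.re_shiftedExponent_nonpos {X : ℝ≥0 → Ω → ℝ} {b C G M Y S₀ : ℝ}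
    (hX : IsCGMYProcess X P b C G M Y) (hM : 1 < M) (hS₀ : 0 < S₀)
    (hS : IsMartingale (assetPrice S₀ X) P) (v : ℝ) : (shiftedExponent C G M Y v).re ≤ 0 := by
  have h := norm_complexMGF_le_mgf (X := X 1) (μ := P) (z := 1 / 2 + v * Complex.I)
  rw [hX.complexMGF_half hM hS₀ hS, Complex.norm_exp, NNReal.coe_one, Complex.ofReal_one,
    one_mul] at h
  have hint := hS.integrable_exp hS₀ 1
  have h2 : mgf (X 1) P (1 / 2 + v * Complex.I).re ≤ 1 := by
    have e : (1 / 2 + v * Complex.I).re = 1 / 2 := by simp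
    rw [e, mgf]
    have : ∫ ω, Real.exp (1 / 2 * X 1 ω) ∂P ≤ ∫ ω, (1 + Real.exp (X 1 ω)) / 2 ∂P := by
      refine integral_mono_of_nonneg (ae_of_all _ fun ω => (Real.exp_pos _).le)
        (((integrable_const _).add hint).div_const 2) (ae_of_all _ fun ω => ?_)
      have e2 : Real.exp (X 1 ω) = Real.exp (1 / 2 * X 1 ω) ^ 2 := by
        rw [← Real.exp_nat_mul]; push_cast; ring_nf
      simp only []
      rw [e2]
      nlinarith [sq_nonneg (Real.exp (1 / 2 * X 1 ω) - 1)]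
    refine this.trans (le_of_eq ?_)
    rw [integral_div, integral_add (integrable_const _) hint,
      hS.integral_exp hS₀ hX.isLevyProcess]
    simp
  exact Real.exp_le_one_iff.1 (h.trans h2)

theorem IsCGMYProcess.callPrice_eq {X : ℝ≥0 → Ω → ℝ} {b C G M Y S₀ : ℝ}
    (hX : IsCGMYProcess X P b C G M Y) (hM : 1 < M) (hS₀ : 0 < S₀)
    (hS : IsMartingale (assetPrice S₀ X) P) (t : ℝ≥0) :
    callPrice S₀ X P t 0 = 1 / Real.pi * ∫ v in Ioi (0 : ℝ),
      (1 - Real.exp (t * (shiftedExponent C G M Y v).re) *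
        Real.cos (t * (shiftedExponent C G M Y v).im)) / (v ^ 2 + 1 / 4) := by
  have h := integral_max_exp_sub_one (hX.isLevyProcess.measurable t) (hS.integrable_exp hS₀ t)
    (hS.integral_exp hS₀ hX.isLevyProcess t)
  have e : ∀ ω, max (assetPrice S₀ X t ω - S₀ * Real.exp (-0)) 0 =
      S₀ * max (Real.exp (X t ω) - 1) 0 := fun ω => by
    rw [mul_max_of_nonneg _ _ hS₀.le, mul_zero, neg_zero, Real.exp_zero, assetPrice, mul_sub]
  rw [callPrice]
  simp only [e]
  rw [integral_const_mul, ← mul_assoc, one_div_mul_cancel hS₀.ne', one_mul, h]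
  simp only [hX.complexMGF_half hM hS₀ hS, Complex.exp_re, Complex.re_ofReal_mul,
    Complex.im_ofReal_mul]

theorem tendsto_coe_nhdsGT_zero : Tendsto (fun t : ℝ≥0 => (t : ℝ)) (𝓝[>] 0) (𝓝[>] 0) := by
  refine tendsto_nhdsWithin_iff.2 ⟨?_, ?_⟩
  · exact (NNReal.continuous_coe.tendsto 0).mono_left nhdsWithin_le_nhds
  · filter_upwards [self_mem_nhdsWithin] with t ht
    exact NNReal.coe_pos.2 ht

end CGMY

theorem mainTheorem2 {Ω : Type*} [MeasurableSpace Ω] {P : Measure Ω} [IsProbabilityMeasure P]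
    {X : ℝ≥0 → Ω → ℝ} {b C G M Y S₀ : ℝ}
    (hX : CGMY.IsCGMYProcess X P b C G M Y) (hM : 1 < M) (hS₀ : 0 < S₀)
    (hS : CGMY.IsMartingale (CGMY.assetPrice S₀ X) P) :
    -- the closed form of the contour-shifted exponent
    (∀ v : ℝ, CGMY.psi0 b C G M Y v =
      Complex.I * v * (CGMY.bTilde C G M Y : ℂ) + (CGMY.kappa C G M Y : ℂ) +
        (C : ℂ) * (Real.Gamma (-Y) : ℂ) *
          ((((M - 1 / 2 : ℝ) : ℂ) - Complex.I * v) ^ (Y : ℂ) +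
            (((G + 1 / 2 : ℝ) : ℂ) + Complex.I * v) ^ (Y : ℂ))) ∧
    -- the limiting stable exponent is real
    (∀ u : ℝ, CGMY.theta0 C Y u =
      ((-(2 * C * Real.Gamma (-Y) * |Real.cos (Real.pi * Y / 2)|) * |u| ^ Y : ℝ) : ℂ)) ∧
    -- the first-order coefficient: convergence and closed form
    IntegrableOn (CGMY.d1Integrand C Y) (Ioi 0) ∧
    CGMY.d1 C Y = 1 / Real.pi * Real.Gamma (1 - 1 / Y) *
      (2 * C * Real.Gamma (-Y) * |Real.cos (Real.pi * Y / 2)|) ^ (1 / Y) ∧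
    -- the second-order coefficient: convergence
    IntegrableOn (CGMY.d2Integrand b C G M Y) (Ioi 0) ∧
    -- the second-order expansion of the at-the-money call price
    (fun t : ℝ≥0 => CGMY.callPrice S₀ X P t 0 -
        (CGMY.d1 C Y * (t : ℝ) ^ (1 / Y) + CGMY.d2 b C G M Y * (t : ℝ)))
      =o[𝓝[>] 0] (fun t : ℝ≥0 => (t : ℝ)) := by
  have h1 := hX.one_lt_Y
  have h2 := hX.Y_lt_two
  set k := 2 * C * Real.Gamma (-Y) * |Real.cos (Real.pi * Y / 2)| with hk
  have hk0 : 0 < k := mul_pos (mul_pos (mul_pos two_pos hX.C_pos) (CGMY.Gamma_neg_pos h1 h2))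
    (abs_pos.2 (CGMY.cos_pi_mul_half_neg h1 h2).ne)
  have hθ : ∀ u : ℝ, CGMY.theta0 C Y u = ((-k * |u| ^ Y : ℝ) : ℂ) := CGMY.theta0_eq h1 h2
  have hψ := hX.psi0_eq hM hS₀ hS
  obtain ⟨K, hK, hb⟩ := CGMY.exists_shiftedExponent_bound hX.C_pos hX.G_nonneg hM h1 h2
  have hmeas := CGMY.measurable_shiftedExponent C G M Y
  obtain ⟨hint, hlim⟩ := CGMY.integrableOn_limit_and_tendsto h1 h2 hk0 hK
    (Complex.measurable_re.comp hmeas) (Complex.measurable_im.comp hmeas)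
    (fun v _ => hX.re_shiftedExponent_nonpos hM hS₀ hS v) (fun v hv => (hb v hv).1)
    (fun v hv => (hb v hv).2)
  have e1 : ∀ u ∈ Ioi (0 : ℝ), (((1 - Real.exp (-k * u ^ Y)) / u ^ 2 : ℝ) : ℂ) =
      CGMY.d1Integrand C Y u := fun u hu => by
    rw [CGMY.d1Integrand, hθ, abs_of_pos hu]
    push_cast
    rfl
  have e2 : ∀ v ∈ Ioi (0 : ℝ), ((v ^ 2 + 1 / 4) * (-k * v ^ Y) -
      v ^ 2 * (CGMY.shiftedExponent C G M Y v).re) / (v ^ 2 * (v ^ 2 + 1 / 4)) =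
      CGMY.d2Integrand b C G M Y v := fun v hv => by
    rw [CGMY.d2Integrand, hθ, hψ, abs_of_pos hv, Complex.ofReal_re]
  have hd1 : CGMY.d1 C Y = 1 / Real.pi * Real.Gamma (1 - 1 / Y) * k ^ (1 / Y) := by
    rw [CGMY.d1, ← setIntegral_congr_fun measurableSet_Ioi e1, integral_complex_ofReal,
      Complex.ofReal_re, CGMY.integral_one_sub_exp_div_sq h1 hk0]
    ring
  have hd2 : CGMY.d2 b C G M Y = 1 / Real.pi * ∫ v in Ioi (0 : ℝ), ((v ^ 2 + 1 / 4) *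
      (-k * v ^ Y) - v ^ 2 * (CGMY.shiftedExponent C G M Y v).re) /
      (v ^ 2 * (v ^ 2 + 1 / 4)) := by
    rw [CGMY.d2, setIntegral_congr_fun measurableSet_Ioi e2]
  refine ⟨hψ, hθ, ?_, hd1, hint.congr_fun e2 measurableSet_Ioi, ?_⟩
  · exact IntegrableOn.congr_fun (Integrable.ofReal (CGMY.integrableOn_one_sub_exp_div_sq h1 hk0))
      e1 measurableSet_Ioi
  · have hpos : ∀ᶠ t : ℝ≥0 in 𝓝[>] 0, (t : ℝ) ≠ 0 := by
      filter_upwards [self_mem_nhdsWithin] with t ht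
      exact (NNReal.coe_pos.2 ht).ne'
    rw [isLittleO_iff_tendsto' (hpos.mono fun t ht h => absurd h ht)]
    -- The limit of the difference quotient, times `1/π`, is `d₂`; subtracting it leaves the
    -- quotient of the remainder by `t`.
    have h3 := ((hlim.comp CGMY.tendsto_coe_nhdsGT_zero).const_mul (1 / Real.pi)).sub_const
      (CGMY.d2 b C G M Y)
    simp only [Function.comp_apply] at h3
    rw [← hd2, sub_self] at h3
    refine h3.congr' (hpos.mono fun t ht => ?_)
    simp only [hX.callPrice_eq hM hS₀ hS, hd1]
    field_simp
    ring_nf
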